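/- Let $n \ge 1$ and let $\Sigma$ be a fan in $\mathbb{R}^n$ (with lattice $\mathbb{Z}^n$) whose toric variety $X$ is smooth, complete and Fano (the anticanonical bundle of $X$ is ample). Let $A \subset \mathbb{Z}^n$ be the set of primitive generators of the rays of $\Sigma$; for nonzero $c_\alpha \in \mathbb{C}$ $(\alpha \in A)$ let $W_\Sigma = \sum_{\alpha \in A} c_\alpha z^\alpha$ on $(\mathbb{C}^*)^n$. Definitions. Write $\operatorname{Log}(z) = (\log|z_1|, \dots, \log|z_n|)$. A toric Kähler form $\omega$ on $(\mathbb{C}^*)^n$ (Kähler for the standard complex structure and invariant under $T^n$) is *radial* if $\omega = \omega_\varphi = \sum_j d\big(\tfrac{\partial \varphi}{\partial u_j}\big) \wedge d\theta_j$ with $u = \operatorname{Log}(z)$, for a smooth strictly convex $\varphi : \mathbb{R}^n \to \mathbb{R}$ with nondegenerate Hessian whose Legendre transform $\Phi = \nabla \varphi$ is a bijection of $\mathbb{R}^n$ that takes rays to rays outside of a compact set. Then $\mu = \Phi \circ \operatorname{Log}$ is a moment map for $\omega$. A *monomial division* for $W_\Sigma$ and $\mu$ with exponents $k_\alpha > 0$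 is a choice of closed sets $C_\alpha \subset \mathbb{R}^n$ $(\alpha \in A)$ that cover the complement of a compact subset of $\mathbb{R}^n$, such that for every $z \in (\mathbb{C}^*)^n$ the maximum $\max_{\alpha \in A} |c_\alpha z^\alpha|^{k_\alpha}$ is achieved by some $\alpha$ with $\mu(z) \in C_\alpha$. It is *adapted to $\Sigma$* if for each $\alpha \in A$ there is a compact subset of $\mu^{-1}(C_\alpha)$ whose complement in $\mu^{-1}(C_\alpha)$ is mapped by $\mu$ into the interior of the star of $\alpha$, i.e. of the union of the cones of $\Sigma$ that have the ray generated by $\alpha$ as a face. The *tropical division* with parameter $\delta \in [0,1]$ has $C_\alpha$ equal to the region of points $\mu(z)$ where $|c_\alpha z^\alpha| \ge (1 - \delta) \max_{\beta \in A} |c_\beta z^\beta|$. Statement. There is a radial toric Kähler form $\omega = \omega_\varphi$ on $(\mathbb{C}^*)^n$, depending only on $\Sigma$, such that, with the moment map $\mu = \Phi \circ \operatorname{Log}$: 1. for all nonzero coefficients $c_\alpha$, $W_\Sigma$ admits a monomial division for $\mu$ that is adapted to $\Sigma$ and has $k_\alpha = 1$ for all $\alpha \in A$; 2. moreover, there is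 $\delta_0 \in (0,1]$ such that for all nonzero coefficients $c_\alpha$ and every $\delta \in [0, \delta_0]$, the tropical division for $W_\Sigma$ with parameter $\delta$ is a monomial division for $\mu$ with all $k_\alpha = 1$ and is adapted to $\Sigma$. -/

import Mathlib

open scoped ContDiff

noncomputable section

namespace ToricMirror

/-! ### Smooth fans -/

/-- The lattice vector `α ∈ ℤⁿ` as a vector of `ℝⁿ`. -/
def toReal {n : ℕ} (α : Fin n → ℤ) : EuclideanSpace ℝ (Fin n) :=
  WithLp.toLp 2 (fun i => (α i : ℝ))

/-- The convex cone `⟨S⟩ ⊆ ℝⁿ` generated by a finite set `S` of lattice vectors. -/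
def coneOf {n : ℕ} (S : Finset (Fin n → ℤ)) : Set (EuclideanSpace ℝ (Fin n)) :=
  {u | ∃ a : (Fin n → ℤ) → ℝ, (∀ α ∈ S, 0 ≤ a α) ∧ u = ∑ α ∈ S, a α • toReal α}

/-- A smooth fan in `ℝⁿ` with respect to the lattice `ℤⁿ`.  Every cone of a smooth fan is generated
by part of a `ℤ`-basis of `ℤⁿ`; it is recorded by its finite set `S` of primitive generators, so
that the cone itself is `coneOf S` and its faces are the cones `coneOf T` with `T ⊆ S`. -/
structure SmoothFan (n : ℕ) where
  /-- the sets of primitive generators of the cones of the fan -/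
  cones : Finset (Finset (Fin n → ℤ))
  /-- the zero cone belongs to the fan -/
  empty_mem : ∅ ∈ cones
  /-- faces of cones are cones -/
  face_mem : ∀ S ∈ cones, ∀ T ⊆ S, T ∈ cones
  /-- every cone is generated by part of a lattice basis -/
  smooth : ∀ S ∈ cones, ∃ b : Module.Basis (Fin n) ℤ (Fin n → ℤ), (S : Set (Fin n → ℤ)) ⊆ Set.range b
  /-- two cones meet in a common face -/
  inter_face : ∀ S ∈ cones, ∀ T ∈ cones, coneOf S ∩ coneOf T = coneOf (S ∩ T)

namespace SmoothFan

variable {n : ℕ} (F : SmoothFan n)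

/-- The set `A` of primitive generators of the rays of the fan. -/
def rays : Finset (Fin n → ℤ) := F.cones.biUnion id

/-- The fan is complete: its cones cover `ℝⁿ` (equivalently, the toric variety is complete). -/
def IsComplete : Prop := ∀ u : EuclideanSpace ℝ (Fin n), ∃ S ∈ F.cones, u ∈ coneOf S

/-- The star of (the ray generated by) `α`: the union of the cones of the fan that contain the ray
generated by `α` as a face. -/
def star (α : Fin n → ℤ) : Set (EuclideanSpace ℝ (Fin n)) :=
  {u | ∃ S ∈ F.cones, α ∈ S ∧ u ∈ coneOf S}

/-! ### The toric variety of the fan in homogeneous coordinates, and the Fano condition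

For a smooth complete fan with set of rays `A`, the toric variety is the quotient
`X = (ℂ^A ∖ Z) / G` of the open set `coxOpen` by the free action of the group `coxGroup`.  The
tangent bundle of `X` is the quotient of `ℂ^A` (with the action of `G`) by the trivial bundle
`Lie G`, so the anticanonical bundle of `X` is the line bundle associated with the character
`t ↦ ∏ t_α` of `G`. -/

/-- `ℂ^A ∖ Z`: the points for which the set of vanishing coordinates is a cone of the fan. -/
def coxOpen : Set (F.rays → ℂ) :=
  {x | ∃ S ∈ F.cones, ∀ α : F.rays, x α = 0 → (α : Fin n → ℤ) ∈ S}

/-- The group `G = {t ∈ (ℂˣ)^A : ∏_α t_α ^ ⟨m, α⟩ = 1 for all m ∈ ℤⁿ}` (it is enough to let `m` run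
over the standard basis of `ℤⁿ`). -/
def coxGroup : Subgroup (F.rays → ℂˣ) where
  carrier := {t | ∀ i : Fin n, ∏ α : F.rays, t α ^ ((α : Fin n → ℤ) i) = 1}
  one_mem' := by intro i; simp
  mul_mem' := by
    intro s t hs ht i
    simp only [Pi.mul_apply, mul_zpow, Finset.prod_mul_distrib, hs i, ht i, mul_one]
  inv_mem' := by
    intro t ht i
    simp only [Pi.inv_apply, inv_zpow, Finset.prod_inv_distrib, ht i, inv_one]

/-- The global sections of the `k`-th power of the anticanonical bundle `O(-k K_X)`: the polynomials
`s` on `ℂ^A` with `s (t x) = (∏ t_α)^k s (x)` for `t ∈ G`.  (Regular functions on `ℂ^A ∖ Z` are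
polynomials, since `Z` has codimension at least two.) -/
def antiCanonicalSections (k : ℕ) : Set (MvPolynomial F.rays ℂ) :=
  {s | ∀ t ∈ F.coxGroup, ∀ x : F.rays → ℂ,
    MvPolynomial.eval (fun α => (t α : ℂ) * x α) s
      = (∏ α, (t α : ℂ)) ^ k * MvPolynomial.eval x s}

/-- The derivative of the polynomial `s` at the point `x` in the direction `v`. -/
def dirDeriv (s : MvPolynomial F.rays ℂ) (x v : F.rays → ℂ) : ℂ :=
  ∑ α, MvPolynomial.eval x (MvPolynomial.pderiv α s) * v α

/-- `O(-k K_X)` is very ample: its sections have no common zero and the induced map from `X` to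
projective space is injective and an immersion, that is, an embedding of the compact manifold `X`.
The tangent space of `X` at the class of `x` is the quotient of `ℂ^A` by the tangent space of the
orbit `G x`, which consists of the vectors `(ξ_α x_α)` with `∑_α ξ_α α = 0`. -/
structure AntiCanonicalVeryAmple (k : ℕ) : Prop where
  base_point_free : ∀ x ∈ F.coxOpen, ∃ s ∈ F.antiCanonicalSections k, MvPolynomial.eval x s ≠ 0
  separates_points : ∀ x ∈ F.coxOpen, ∀ y ∈ F.coxOpen,
    (∃ c : ℂ, c ≠ 0 ∧
      ∀ s ∈ F.antiCanonicalSections k, MvPolynomial.eval y s = c * MvPolynomial.eval x s) →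
    ∃ t ∈ F.coxGroup, ∀ α, y α = (t α : ℂ) * x α
  separates_tangents : ∀ x ∈ F.coxOpen, ∀ v : F.rays → ℂ,
    (∃ c : ℂ, ∀ s ∈ F.antiCanonicalSections k, F.dirDeriv s x v = c * MvPolynomial.eval x s) →
    ∃ ξ : F.rays → ℂ, (∀ i : Fin n, ∑ α : F.rays, ξ α * (((α : Fin n → ℤ) i : ℤ) : ℂ) = 0) ∧
      ∀ α, v α = ξ α * x α

/-- The toric variety of the (smooth) fan is Fano: it is complete and its anticanonical bundle is
ample, i.e. some positive power of it is very ample. -/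
structure IsFano : Prop where
  complete : F.IsComplete
  ample : ∃ k : ℕ, 0 < k ∧ F.AntiCanonicalVeryAmple k

end SmoothFan

/-! ### Toric Kähler forms on `(ℂ*)ⁿ` -/

/-- The algebraic torus `(ℂ*)ⁿ` as an open subset of `ℂⁿ`. -/
def torus (n : ℕ) : Set (Fin n → ℂ) := {z | ∀ i, z i ≠ 0}

/-- `Log z = (log |z₁|, …, log |z_n|)`. -/
def Log {n : ℕ} (z : Fin n → ℂ) : EuclideanSpace ℝ (Fin n) :=
  WithLp.toLp 2 (fun i => Real.log ‖z i‖)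

/-- The `1`-form `dθ_j` on `(ℂ*)ⁿ`, that is, the imaginary part of `dz_j / z_j`. -/
def dTheta {n : ℕ} (j : Fin n) (z v : Fin n → ℂ) : ℝ := (v j / z j).im

/-- The vector field `∂/∂θ_j` on `(ℂ*)ⁿ`, generating the rotation of the `j`-th coordinate. -/
def rotationField {n : ℕ} (j : Fin n) (z : Fin n → ℂ) : Fin n → ℂ :=
  Pi.single j (Complex.I * z j)

/-- A `T^n`-invariant Kähler form on `(ℂ*)ⁿ` with its standard complex structure. -/
structure IsToricKahlerForm {n : ℕ} (Ω : (Fin n → ℂ) → (Fin n → ℂ) [⋀^Fin 2]→L[ℝ] ℝ) : Prop where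
  smooth : ContDiffOn ℝ ∞ Ω (torus n)
  closed : ∀ z ∈ torus n, extDeriv Ω z = 0
  compatible : ∀ z ∈ torus n, ∀ v w : Fin n → ℂ,
    Ω z ![Complex.I • v, Complex.I • w] = Ω z ![v, w]
  positive : ∀ z ∈ torus n, ∀ v : Fin n → ℂ, v ≠ 0 → 0 < Ω z ![v, Complex.I • v]
  invariant : ∀ t : Fin n → ℂ, (∀ i, ‖t i‖ = 1) → ∀ z ∈ torus n, ∀ v w : Fin n → ℂ,
    Ω (t * z) ![t * v, t * w] = Ω z ![v, w]

/-- `μ` is a moment map for the standard action of `T^n` on `(ℂ*)ⁿ` and the form `Ω`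
(with the sign convention `d μ_j = Ω (·, ∂/∂θ_j)`). -/
structure IsMomentMap {n : ℕ} (Ω : (Fin n → ℂ) → (Fin n → ℂ) [⋀^Fin 2]→L[ℝ] ℝ)
    (μ : (Fin n → ℂ) → EuclideanSpace ℝ (Fin n)) : Prop where
  differentiable : ∀ z ∈ torus n, DifferentiableAt ℝ μ z
  hamiltonian : ∀ z ∈ torus n, ∀ j : Fin n, ∀ v : Fin n → ℂ,
    fderiv ℝ (fun y => μ y j) z v = Ω z ![v, rotationField j z]
  invariant : ∀ t : Fin n → ℂ, (∀ i, ‖t i‖ = 1) → ∀ z ∈ torus n, μ (t * z) = μ z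

/-- `Ω = Ω_φ = ∑_j d (∂φ/∂u_j) ∧ dθ_j` on `(ℂ*)ⁿ`, where `u = Log z`. -/
def HasPotential {n : ℕ} (Ω : (Fin n → ℂ) → (Fin n → ℂ) [⋀^Fin 2]→L[ℝ] ℝ)
    (φ : EuclideanSpace ℝ (Fin n) → ℝ) : Prop :=
  ∀ z ∈ torus n, ∀ v w : Fin n → ℂ, Ω z ![v, w] =
    ∑ j, (fderiv ℝ (fun y => gradient φ (Log y) j) z v * dTheta j z w
      - fderiv ℝ (fun y => gradient φ (Log y) j) z w * dTheta j z v)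

/-- `φ` is a smooth strictly convex function with nondegenerate Hessian whose Legendre transform
`Φ = ∇φ` is a bijection of `ℝⁿ` that takes rays (from the origin) to rays outside of a compact
set. -/
structure IsRadialPotential {n : ℕ} (φ : EuclideanSpace ℝ (Fin n) → ℝ) : Prop where
  smooth : ContDiff ℝ ∞ φ
  strictConvex : StrictConvexOn ℝ Set.univ φ
  nondegenerate : ∀ u v : EuclideanSpace ℝ (Fin n),
    (∀ w : EuclideanSpace ℝ (Fin n), iteratedFDeriv ℝ 2 φ u ![v, w] = 0) → v = 0
  bijective : Function.Bijective (gradient φ)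
  rays_to_rays : ∃ K : Set (EuclideanSpace ℝ (Fin n)), IsCompact K ∧
    ∀ u ∉ K, ∀ t : ℝ, 0 < t → t • u ∉ K → ∃ s : ℝ, 0 < s ∧ gradient φ (t • u) = s • gradient φ u

/-- `Ω` is a radial toric Kähler form on `(ℂ*)ⁿ`, given by the potential `φ`. -/
structure IsRadialToricKahler {n : ℕ} (Ω : (Fin n → ℂ) → (Fin n → ℂ) [⋀^Fin 2]→L[ℝ] ℝ)
    (φ : EuclideanSpace ℝ (Fin n) → ℝ) : Prop where
  kahler : IsToricKahlerForm Ω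
  potential : IsRadialPotential φ
  eq_potential : HasPotential Ω φ

/-! ### Monomial divisions -/

/-- The Laurent monomial `z^α`. -/
def monomial {n : ℕ} (z : Fin n → ℂ) (α : Fin n → ℤ) : ℂ := ∏ i, z i ^ α i

/-- The closed sets `C_α`, `α ∈ A`, form a monomial division for `W = ∑_{α ∈ A} c_α z^α` and `μ`,
with exponents `k_α > 0` in the second condition. -/
structure IsMonomialDivision {n : ℕ} (A : Finset (Fin n → ℤ)) (c : (Fin n → ℤ) → ℂ)
    (μ : (Fin n → ℂ) → EuclideanSpace ℝ (Fin n)) (k : (Fin n → ℤ) → ℝ)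
    (C : (Fin n → ℤ) → Set (EuclideanSpace ℝ (Fin n))) : Prop where
  closed : ∀ α ∈ A, IsClosed (C α)
  cover : ∃ K : Set (EuclideanSpace ℝ (Fin n)), IsCompact K ∧ ∀ p ∉ K, ∃ α ∈ A, p ∈ C α
  pos : ∀ α ∈ A, 0 < k α
  max_achieved : ∀ z ∈ torus n, ∃ α ∈ A, μ z ∈ C α ∧
    ∀ β ∈ A, ‖c β * monomial z β‖ ^ k β ≤ ‖c α * monomial z α‖ ^ k α

/-- The sets `C_α` are adapted to the fan: for each `α ∈ A`, the image under `μ` of the complement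
of a compact subset of `μ⁻¹(C_α)` is contained in the interior of the star of `α`. -/
def IsAdapted {n : ℕ} (F : SmoothFan n) (μ : (Fin n → ℂ) → EuclideanSpace ℝ (Fin n))
    (C : (Fin n → ℤ) → Set (EuclideanSpace ℝ (Fin n))) : Prop :=
  ∀ α ∈ F.rays, ∃ K ⊆ torus n ∩ μ ⁻¹' (C α), IsCompact K ∧
    ∀ z ∈ (torus n ∩ μ ⁻¹' (C α)) \ K, μ z ∈ interior (F.star α)

/-- The tropical division with parameter `δ`: `C_α` is the region of points `μ z` for which
`|c_α z^α| ≥ (1 - δ) max_{β ∈ A} |c_β z^β|`. -/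
def tropicalDivision {n : ℕ} (A : Finset (Fin n → ℤ)) (c : (Fin n → ℤ) → ℂ)
    (μ : (Fin n → ℂ) → EuclideanSpace ℝ (Fin n)) (δ : ℝ) (α : Fin n → ℤ) :
    Set (EuclideanSpace ℝ (Fin n)) :=
  μ '' {z | z ∈ torus n ∧
    ∀ β ∈ A, (1 - δ) * ‖c β * monomial z β‖ ≤ ‖c α * monomial z α‖}

end ToricMirror

end

noncomputable section

namespace ToricMirror

open Filter Topology

/-! ### Support functions of cones of a Fano fan -/

namespace SmoothFan

variable {n : ℕ} (F : SmoothFan n)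

/-! The potential is `φ = T² / 2`, where away from a compact set `T` is the gauge of the convex body
`{v | ∑ exp ⟨β, v⟩ ≤ L}`, summed over the rays `β`. There `φ` is homogeneous of degree 2, so `∇φ` is
homogeneous of degree 1 and takes rays to rays. With `v = u / T`, the vector `∇φ(u)` is a positive
multiple of `∑ exp ⟨β, v⟩ β` (`gradient_gaugePotential`), which leans towards the rays whose
monomials dominate.

The Fano condition enters through `IsFano.exists_support_functional`: for each cone `S` and each ray
`α` outside it there is `m` with `⟨m, ·⟩` equal to 1 on the generators of `S`, at most 1 on all
rays, and at most `1 - c` at `α`. Such `m` come from the exponents of anticanonical sections near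
the orbit of `S`. If `α` is dominant at `v` up to an error 1 and `M = ⟨α, v⟩ + 1`, then `M m - v` is
nonnegative on `S`. It is negative on `∑ exp ⟨β, v⟩ β` once `M` is large, because the gain `c M exp
(M - 1)` at `α` beats the total error `N exp M`, where `N` is the number of rays. A large `L` forces
`M` to be large. The weighted sum thus avoids every cone not containing `α`, and lies in the
interior of the star (`weighted_sum_mem_interior_star`). Coefficients, and a factor `1 - δ ≥ 1/2`,
perturb exponents by a bounded amount, which division by a large `T` makes less than 1; so `L`, and
with it `φ`, depends on the fan alone.

To make `T` smooth and positive on all of `ℝⁿ`, it is defined by `∑ T exp (⟨β, u⟩ / T) - L T + g(T)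
= 0` with a convex tail `g` vanishing on `[2, ∞)`. The implicit function theorem gives smoothness,
two implicit differentiations give a positive Hessian (`fderiv_fderiv_gaugePotential_pos`), and
quadratic growth makes `∇φ` proper and bijective. -/

theorem mem_rays_of_mem {S : Finset (Fin n → ℤ)} (hS : S ∈ F.cones) {α : Fin n → ℤ} (hα : α ∈ S) :
    α ∈ F.rays :=
  Finset.mem_biUnion.2 ⟨S, hS, hα⟩

theorem exists_cone_of_mem_rays {α : Fin n → ℤ} (hα : α ∈ F.rays) : ∃ S ∈ F.cones, α ∈ S :=
  Finset.mem_biUnion.1 hα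

theorem ne_zero_of_mem_rays {α : Fin n → ℤ} (hα : α ∈ F.rays) : α ≠ 0 := by
  obtain ⟨S, hS, hαS⟩ := F.exists_cone_of_mem_rays hα
  obtain ⟨b, hb⟩ := F.smooth S hS
  obtain ⟨i, rfl⟩ := hb hαS
  exact b.ne_zero i

theorem toReal_apply (α : Fin n → ℤ) (i : Fin n) : toReal α i = α i := rfl

theorem toReal_ne_zero {α : Fin n → ℤ} (hα : α ≠ 0) : toReal α ≠ 0 := fun h => hα <| by
  ext i
  have : ((α i : ℤ) : ℝ) = 0 := by rw [← toReal_apply, h]; rfl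
  exact_mod_cast this

/-- The only cone of the fan that contains a primitive ray generator among its points also has it
among its generators. -/
theorem mem_of_toReal_mem_coneOf {S : Finset (Fin n → ℤ)} (hS : S ∈ F.cones) {α : Fin n → ℤ}
    (hα : α ∈ F.rays) (h : toReal α ∈ coneOf S) : α ∈ S := by
  by_contra hαS
  obtain ⟨T, hT, hαT⟩ := F.exists_cone_of_mem_rays hα
  have hα1 : {α} ∈ F.cones := F.face_mem T hT _ (Finset.singleton_subset_iff.2 hαT)
  have hmem : toReal α ∈ coneOf S ∩ coneOf {α} := ⟨h, fun _ => 1, by simp, by simp⟩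
  rw [F.inter_face S hS _ hα1, Finset.inter_singleton_of_notMem hαS] at hmem
  obtain ⟨a, _, ha⟩ := hmem
  exact toReal_ne_zero (F.ne_zero_of_mem_rays hα) (by simpa using ha)

/-- The distinguished point of the orbit of the cone generated by `S`. -/
def orbitPoint (S : Finset (Fin n → ℤ)) (α : F.rays) : ℂ := if (α : Fin n → ℤ) ∈ S then 0 else 1

theorem orbitPoint_mem_coxOpen {S : Finset (Fin n → ℤ)} (hS : S ∈ F.cones) :
    F.orbitPoint S ∈ F.coxOpen :=
  ⟨S, hS, fun α hα => by simpa [orbitPoint] using hα⟩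

theorem eval_mul_eq_sum (s : MvPolynomial F.rays ℂ) (t x : F.rays → ℂ) :
    MvPolynomial.eval (fun α => t α * x α) s =
      MvPolynomial.eval x (∑ e ∈ s.support, MvPolynomial.monomial e (s.coeff e * ∏ α, t α ^ e α)) := by
  rw [MvPolynomial.eval_eq', map_sum]
  refine Finset.sum_congr rfl fun e _ => ?_
  rw [MvPolynomial.eval_monomial, Finsupp.prod_fintype _ _ (by simp)]
  simp only [mul_pow, Finset.prod_mul_distrib]
  ring

/-- Distinct monomials are linearly independent, so equivariance of a section passes to each
monomial occurring in it. -/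
theorem prod_pow_of_mem_antiCanonicalSections {k : ℕ} {s : MvPolynomial F.rays ℂ}
    (hs : s ∈ F.antiCanonicalSections k) {e : F.rays →₀ ℕ} (he : e ∈ s.support)
    {t : F.rays → ℂˣ} (ht : t ∈ F.coxGroup) :
    ∏ α, (t α : ℂ) ^ e α = (∏ α, (t α : ℂ)) ^ k := by
  have h : ∑ e ∈ s.support, MvPolynomial.monomial e (s.coeff e * ∏ α, (t α : ℂ) ^ e α) =
      MvPolynomial.C ((∏ α, (t α : ℂ)) ^ k) * s := by
    refine MvPolynomial.funext fun x => ?_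
    rw [← eval_mul_eq_sum, hs t ht x]
    simp
  have hc := congrArg (MvPolynomial.coeff e) h
  rw [MvPolynomial.coeff_C_mul, MvPolynomial.coeff_sum] at hc
  simp only [MvPolynomial.coeff_monomial, Finset.sum_ite_eq', he, if_true] at hc
  rw [mul_comm] at hc
  exact mul_right_cancel₀ (MvPolynomial.mem_support_iff.1 he) hc

/-- The exponents of anticanonical sections are orthogonal, up to the shift by `k`, to the relations
between the rays. -/
theorem sum_relation_mul_exponent {k : ℕ} {s : MvPolynomial F.rays ℂ}
    (hs : s ∈ F.antiCanonicalSections k) {e : F.rays →₀ ℕ} (he : e ∈ s.support) {ξ : F.rays → ℝ}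
    (hξ : ∑ α, ξ α • toReal (α : Fin n → ℤ) = 0) : ∑ α, ξ α * ((e α : ℝ) - k) = 0 := by
  -- Exponentiating a real relation gives an element of the group; the logarithm of the equivariance
  -- identity is then the linear identity sought.
  set t : F.rays → ℂˣ := fun α => Units.mk0 ((Real.exp (ξ α) : ℝ) : ℂ)
    (by exact_mod_cast (Real.exp_pos _).ne') with ht
  have htG : t ∈ F.coxGroup := by
    intro i
    ext
    have hi : ∑ α : F.rays, ξ α * ((α : Fin n → ℤ) i : ℝ) = 0 := by
      have := congrArg (fun u : EuclideanSpace ℝ (Fin n) => u i) hξ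
      simpa [Finset.sum_apply, toReal_apply] using this
    push_cast [ht, Units.val_mk0]
    have : ∀ α : F.rays, ((Real.exp (ξ α) : ℝ) : ℂ) ^ ((α : Fin n → ℤ) i)
        = ((Real.exp (ξ α * ((α : Fin n → ℤ) i : ℝ)) : ℝ) : ℂ) := fun α => by
      rw [Real.exp_mul, Real.rpow_intCast]
      push_cast
      rfl
    simp only [← Complex.ofReal_exp, this]
    rw [← Complex.ofReal_prod, ← Real.exp_sum, hi]
    simp
  have h := F.prod_pow_of_mem_antiCanonicalSections hs he htG
  simp only [ht, Units.val_mk0] at h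
  norm_cast at h
  simp only [← Real.exp_nat_mul, ← Real.exp_sum] at h
  have h2 := Real.exp_injective h
  simp only [mul_sub, Finset.sum_sub_distrib]
  rw [Finset.mul_sum] at h2
  simp only [mul_comm (ξ _)]
  linarith

/-- A functional that kills the kernel of `ξ ↦ ∑ ξ_α α` factors through that map; the factor is
represented by `m`. -/
theorem exists_inner_eq_of_orthogonal_relations (d : F.rays → ℝ)
    (hd : ∀ ξ : F.rays → ℝ, ∑ α, ξ α • toReal (α : Fin n → ℤ) = 0 → ∑ α, ξ α * d α = 0) :
    ∃ m : EuclideanSpace ℝ (Fin n), ∀ α : F.rays, inner ℝ m (toReal (α : Fin n → ℤ)) = d α := by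
  set M : (F.rays → ℝ) →ₗ[ℝ] EuclideanSpace ℝ (Fin n) :=
    Fintype.linearCombination ℝ fun α : F.rays => toReal (α : Fin n → ℤ) with hM
  set f : (F.rays → ℝ) →ₗ[ℝ] ℝ := Fintype.linearCombination ℝ d with hf
  have hmem : f ∈ M.ker.dualAnnihilator := by
    rw [Submodule.mem_dualAnnihilator]
    intro ξ hξ
    rw [LinearMap.mem_ker] at hξ
    simpa [hf, Fintype.linearCombination_apply] using
      hd ξ (by simpa [hM, Fintype.linearCombination_apply] using hξ)
  rw [← LinearMap.range_dualMap_eq_dualAnnihilator_ker] at hmem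
  obtain ⟨g, hg⟩ := hmem
  refine ⟨(InnerProductSpace.toDual ℝ _).symm (LinearMap.toContinuousLinearMap g), fun α => ?_⟩
  rw [InnerProductSpace.toDual_symm_apply]
  have := LinearMap.congr_fun hg (Pi.single α 1)
  simpa [hM, hf, Fintype.linearCombination_apply_single] using this

theorem exists_exponent_of_eval_orbitPoint_ne_zero {S : Finset (Fin n → ℤ)}
    {s : MvPolynomial F.rays ℂ} (h : MvPolynomial.eval (F.orbitPoint S) s ≠ 0) :
    ∃ e ∈ s.support, ∀ γ : F.rays, (γ : Fin n → ℤ) ∈ S → e γ = 0 := by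
  rw [MvPolynomial.eval_eq'] at h
  obtain ⟨e, he, hne⟩ := Finset.exists_ne_zero_of_sum_ne_zero h
  refine ⟨e, he, fun γ hγ => ?_⟩
  by_contra h0
  refine right_ne_zero_of_mul hne (Finset.prod_eq_zero (Finset.mem_univ γ) ?_)
  simp [orbitPoint, hγ, h0]

theorem dirDeriv_single (s : MvPolynomial F.rays ℂ) (x : F.rays → ℂ) (β : F.rays) :
    F.dirDeriv s x (Pi.single β 1) = MvPolynomial.eval x (MvPolynomial.pderiv β s) := by
  simp [dirDeriv, Pi.single_apply]

/-- The coordinates in `S` vanish at the orbit point, so a monomial contributes to the derivative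
only if removing one factor `x_β` leaves no variable from `S`. -/
theorem exists_exponent_of_eval_pderiv_ne_zero {S : Finset (Fin n → ℤ)}
    {s : MvPolynomial F.rays ℂ} {β : F.rays}
    (h : MvPolynomial.eval (F.orbitPoint S) (MvPolynomial.pderiv β s) ≠ 0) :
    ∃ e ∈ s.support, e β ≠ 0 ∧
      ∀ γ : F.rays, (γ : Fin n → ℤ) ∈ S → e γ ≤ Finsupp.single β 1 γ := by
  rw [s.as_sum, map_sum, map_sum] at h
  obtain ⟨e, he, hne⟩ := Finset.exists_ne_zero_of_sum_ne_zero h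
  rw [MvPolynomial.pderiv_monomial, MvPolynomial.eval_monomial,
    Finsupp.prod_fintype _ _ (by simp)] at hne
  refine ⟨e, he, fun h0 => hne (by simp [h0]), fun γ hγ => ?_⟩
  by_contra h0
  refine right_ne_zero_of_mul hne (Finset.prod_eq_zero (Finset.mem_univ γ) ?_)
  simp only [orbitPoint, hγ, if_true]
  refine zero_pow ?_
  rw [Finsupp.tsub_apply]
  omega

/-- If the tangent direction of the coordinate `β` is separated from zero at the distinguished point
of an orbit only trivially, then it comes from a relation between the rays. -/
theorem exists_relation_of_no_exponent {k : ℕ} (hF : F.AntiCanonicalVeryAmple k)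
    {S : Finset (Fin n → ℤ)} (hS : S ∈ F.cones) (β : F.rays)
    (hno : ∀ s ∈ F.antiCanonicalSections k, ∀ e ∈ s.support, e β ≠ 0 →
      ¬ ∀ γ : F.rays, (γ : Fin n → ℤ) ∈ S → e γ ≤ Finsupp.single β 1 γ) :
    (β : Fin n → ℤ) ∉ S ∧ ∃ ξ : F.rays → ℝ, ∑ α, ξ α • toReal (α : Fin n → ℤ) = 0 ∧ ξ β = 1 ∧
      ∀ γ : F.rays, (γ : Fin n → ℤ) ∉ S → γ ≠ β → ξ γ = 0 := by
  obtain ⟨ξ, hξ, hv⟩ := hF.separates_tangents _ (F.orbitPoint_mem_coxOpen hS) (Pi.single β 1)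
    ⟨0, fun s hs => by
      rw [dirDeriv_single, zero_mul]
      by_contra h
      obtain ⟨e, he, heβ, hall⟩ := F.exists_exponent_of_eval_pderiv_ne_zero h
      exact hno s hs e he heβ hall⟩
  -- At `β ∈ S` the orbit point has coordinate 0, so a vector tangent to the orbit cannot have
  -- `β`-component 1.
  have hβS : (β : Fin n → ℤ) ∉ S := fun h => by
    have := hv β
    simp [orbitPoint, h] at this
  refine ⟨hβS, fun γ => (ξ γ).re, ?_, ?_, fun γ hγ hne => ?_⟩
  · ext i
    have := congrArg Complex.re (hξ i)
    simpa [Finset.sum_apply, toReal_apply] using this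
  · have := hv β
    simp only [Pi.single_eq_same, orbitPoint, hβS, if_false, mul_one] at this
    change (ξ β).re = 1
    rw [← this, Complex.one_re]
  · have := hv γ
    simp only [Pi.single_eq_of_ne hne, orbitPoint, hγ, if_false, mul_one] at this
    change (ξ γ).re = 0
    rw [← this, Complex.zero_re]

/-- If there were no such exponent, the direction `α` would be tangent to the orbit of `S`, giving a
relation `ξ` supported on `S ∪ {α}` with `ξ_α = 1`. The fan axioms give some `γ ∈ S` with `ξ_γ > 0`.
The direction `γ` is never tangent to the orbit, so some exponent `e` has `e_γ ≠ 0` and vanishes on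
the rest of `S`; comparing it with an exponent `e₀` vanishing on `S` contradicts the relation. -/
theorem exists_exponent_vanishing_on_cone {k : ℕ} (hF : F.AntiCanonicalVeryAmple k)
    {S : Finset (Fin n → ℤ)} (hS : S ∈ F.cones) (α : F.rays) (hα : (α : Fin n → ℤ) ∉ S) :
    ∃ s ∈ F.antiCanonicalSections k, ∃ e ∈ s.support,
      (∀ γ : F.rays, (γ : Fin n → ℤ) ∈ S → e γ = 0) ∧ e α ≠ 0 := by
  by_contra! hno
  obtain ⟨-, ξ, hξ, hξα, hξ0⟩ := F.exists_relation_of_no_exponent hF hS α fun s hs e he heα hall =>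
    heα <| hno s hs e he fun γ hγ => by
      have hne : γ ≠ α := fun h => hα (h ▸ hγ)
      have h := hall γ hγ
      rwa [Finsupp.single_eq_of_ne hne, Nat.le_zero] at h
  -- Otherwise `α = -∑ ξ_β β` over `S` has nonnegative coefficients and lies in the cone of `S`.
  obtain ⟨γ, hγS, hγ⟩ : ∃ γ : F.rays, (γ : Fin n → ℤ) ∈ S ∧ 0 < ξ γ := by
    by_contra! hle
    let a : (Fin n → ℤ) → ℝ := fun β => if h : β ∈ F.rays then -ξ ⟨β, h⟩ else 0
    refine hα (F.mem_of_toReal_mem_coneOf hS α.2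
      ⟨a, fun β hβ => ?_, ?_⟩)
    · simp only [a, F.mem_rays_of_mem hS hβ, dif_pos]
      exact neg_nonneg.2 (hle ⟨β, F.mem_rays_of_mem hS hβ⟩ hβ)
    · have h1 : ∑ β ∈ F.rays, a β • toReal β = 0 := by
        rw [← Finset.sum_coe_sort, ← neg_eq_zero, ← Finset.sum_neg_distrib, ← hξ]
        refine Finset.sum_congr rfl fun β _ => ?_
        simp [a]
      have hsub : insert (α : Fin n → ℤ) S ⊆ F.rays :=
        Finset.insert_subset α.2 fun β hβ => F.mem_rays_of_mem hS hβ
      rw [← Finset.sum_subset hsub fun β hβ hβS => ?_, Finset.sum_insert hα] at h1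
      · have haα : a α = -1 := by simp [a, hξα]
        rw [haα, neg_smul, one_smul, neg_add_eq_zero] at h1
        exact h1
      · rw [Finset.mem_insert, not_or] at hβS
        have : ξ ⟨β, hβ⟩ = 0 := hξ0 ⟨β, hβ⟩ hβS.2 fun h => hβS.1 (congrArg Subtype.val h)
        simp [a, hβ, this]
  obtain ⟨s₀, hs₀, hne₀⟩ := hF.base_point_free _ (F.orbitPoint_mem_coxOpen hS)
  obtain ⟨e₀, he₀, hS₀⟩ := F.exists_exponent_of_eval_orbitPoint_ne_zero hne₀
  refine (F.exists_relation_of_no_exponent hF hS γ fun s hs e he heγ hall => ?_).1 hγS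
  have hrel := F.sum_relation_mul_exponent hs he hξ
  have hrel₀ := F.sum_relation_mul_exponent hs₀ he₀ hξ
  have hdiff : ∑ β, ξ β * ((e β : ℝ) - e₀ β) = 0 := by
    rw [← sub_eq_zero.2 (hrel.trans hrel₀.symm), ← Finset.sum_sub_distrib]
    exact Finset.sum_congr rfl fun β _ => by ring
  -- Here `e₀` vanishes at `α` by the assumption `hno`, so every term of the sum is nonnegative and
  -- the `γ` term is positive.
  refine (Finset.sum_pos' (fun β _ => ?_) ⟨γ, Finset.mem_univ _, ?_⟩).ne' hdiff
  · rcases eq_or_ne β α with rfl | hβα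
    · rw [hξα, hno s₀ hs₀ e₀ he₀ hS₀]
      simp
    · by_cases hβS : (β : Fin n → ℤ) ∈ S
      · rcases eq_or_ne β γ with rfl | hβγ
        · rw [hS₀ β hβS]
          have : (0 : ℝ) ≤ e β := Nat.cast_nonneg _
          simpa using mul_nonneg hγ.le this
        · have h := hall β hβS
          rw [Finsupp.single_eq_of_ne hβγ, Nat.le_zero] at h
          rw [h, hS₀ β hβS]
          simp
      · rw [hξ0 β hβS hβα, zero_mul]
  · rw [hS₀ γ hγS]
    have : (0 : ℝ) < e γ := Nat.cast_pos.2 (Nat.pos_of_ne_zero heγ)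
    simpa using mul_pos hγ this

/-- A Fano fan has, for every cone and every ray outside of the cone, a linear functional equal to
`1` on the generators of the cone, at most `1` on all rays and strictly less on the given ray. -/
theorem IsFano.exists_support_functional (hF : F.IsFano) :
    ∃ c > (0 : ℝ), ∀ S ∈ F.cones, ∀ α ∈ F.rays, α ∉ S → ∃ m : EuclideanSpace ℝ (Fin n),
      (∀ β ∈ S, inner ℝ m (toReal β) = 1) ∧ (∀ β ∈ F.rays, inner ℝ m (toReal β) ≤ 1) ∧
        inner ℝ m (toReal α) ≤ 1 - c := by
  obtain ⟨k, hk, hva⟩ := hF.ample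
  have hk0 : (0 : ℝ) < k := Nat.cast_pos.2 hk
  refine ⟨(k : ℝ)⁻¹, inv_pos.2 hk0, fun S hS α hα hαS => ?_⟩
  obtain ⟨s, hs, e, he, heS, heα⟩ := F.exists_exponent_vanishing_on_cone hva hS ⟨α, hα⟩ hαS
  obtain ⟨m, hm⟩ := F.exists_inner_eq_of_orthogonal_relations (fun β => (e β : ℝ) - k)
    fun ξ hξ => F.sum_relation_mul_exponent hs he hξ
  -- With this normalisation, zeros of the exponent become the value 1, and a nonzero exponent costs
  -- at least `1 / k`; hence `c = 1 / k`.
  have hval : ∀ β : F.rays, inner ℝ (-(k : ℝ)⁻¹ • m) (toReal (β : Fin n → ℤ)) = 1 - (k : ℝ)⁻¹ * e β :=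
    fun β => by
      rw [inner_smul_left, hm β]
      simp only [RCLike.conj_to_real]
      field_simp
      ring
  refine ⟨-(k : ℝ)⁻¹ • m, fun β hβ => ?_, fun β hβ => ?_, ?_⟩
  · rw [hval ⟨β, F.mem_rays_of_mem hS hβ⟩, heS _ hβ]
    simp
  · rw [hval ⟨β, hβ⟩]
    have : 0 ≤ (k : ℝ)⁻¹ * e ⟨β, hβ⟩ := by positivity
    linarith
  · rw [hval ⟨α, hα⟩]
    have h1 : (1 : ℝ) ≤ e ⟨α, hα⟩ := by exact_mod_cast Nat.one_le_iff_ne_zero.2 heα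
    have := mul_le_mul_of_nonneg_left h1 (inv_pos.2 hk0).le
    linarith

end SmoothFan

/-! ### A smooth convex function vanishing exactly on a half-line -/

/-- A smooth, convex, nonincreasing function on `ℝ` that vanishes on `[2, ∞)` and is positive
at `0`. -/
def convexTail (t : ℝ) : ℝ := ∫ x in t..2, Real.smoothTransition (2 - x)

theorem hasDerivAt_convexTail (t : ℝ) :
    HasDerivAt convexTail (-Real.smoothTransition (2 - t)) t := by
  have hc : Continuous fun x : ℝ => Real.smoothTransition (2 - x) :=
    Real.smoothTransition.continuous.comp (by fun_prop)
  exact intervalIntegral.integral_hasDerivAt_left (hc.intervalIntegrable _ _)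
    (hc.stronglyMeasurableAtFilter _ _) hc.continuousAt

theorem contDiff_convexTail : ContDiff ℝ ∞ convexTail := by
  rw [contDiff_infty_iff_deriv]
  refine ⟨fun t => (hasDerivAt_convexTail t).differentiableAt, ?_⟩
  have : deriv convexTail = fun t => -Real.smoothTransition (2 - t) :=
    funext fun t => (hasDerivAt_convexTail t).deriv
  rw [this]
  exact (Real.smoothTransition.contDiff.comp (contDiff_const.sub contDiff_id)).neg

theorem convexTail_of_two_le {t : ℝ} (ht : 2 ≤ t) : convexTail t = 0 := by
  unfold convexTail
  rw [intervalIntegral.integral_congr (g := fun _ => 0), intervalIntegral.integral_zero]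
  intro x hx
  rw [Set.uIcc_of_ge ht] at hx
  exact Real.smoothTransition.zero_of_nonpos (by linarith [hx.1])

theorem antitone_convexTail : Antitone convexTail :=
  antitone_of_deriv_nonpos (fun t => (hasDerivAt_convexTail t).differentiableAt) fun t => by
    rw [(hasDerivAt_convexTail t).deriv]
    exact neg_nonpos.2 (Real.smoothTransition.nonneg _)

theorem convexTail_nonneg (t : ℝ) : 0 ≤ convexTail t := by
  rcases le_total 2 t with h | h
  · rw [convexTail_of_two_le h]
  · rw [← convexTail_of_two_le le_rfl]
    exact antitone_convexTail h

theorem convexTail_zero_pos : 0 < convexTail 0 := by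
  have hc : Continuous fun x : ℝ => Real.smoothTransition (2 - x) :=
    Real.smoothTransition.continuous.comp (by fun_prop)
  refine intervalIntegral.intervalIntegral_pos_of_pos_on (hc.intervalIntegrable _ _) ?_ (by norm_num)
  exact fun x hx => Real.smoothTransition.pos_of_pos (by linarith [hx.2])

/-! ### The smoothed support function of a finite set of vectors -/

section Gauge

variable {ι E : Type*} [Fintype ι] [NormedAddCommGroup E] [InnerProductSpace ℝ E]

/-- The function whose zero set `{(u, t) | t > 0}` is the graph of the smoothed gauge. -/
def gaugeEq (a : ι → E) (L : ℝ) (p : E × ℝ) : ℝ :=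
  ∑ i, p.2 * Real.exp (inner ℝ (a i) p.1 / p.2) - L * p.2 + convexTail p.2

/-- The (negated) derivative of `gaugeEq` in the second variable. -/
def gaugeSlope (a : ι → E) (L : ℝ) (p : E × ℝ) : ℝ :=
  L + Real.smoothTransition (2 - p.2)
    - ∑ i, Real.exp (inner ℝ (a i) p.1 / p.2) * (1 - inner ℝ (a i) p.1 / p.2)

theorem contDiffAt_gaugeEq (a : ι → E) (L : ℝ) {p : E × ℝ} (hp : p.2 ≠ 0) :
    ContDiffAt ℝ ∞ (gaugeEq a L) p := by
  unfold gaugeEq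
  refine ContDiffAt.add (ContDiffAt.sub (ContDiffAt.sum fun i _ => ?_) ?_) ?_
  · exact contDiffAt_snd.mul ((contDiffAt_const.inner ℝ contDiffAt_fst).div contDiffAt_snd hp).exp
  · exact contDiffAt_const.mul contDiffAt_snd
  · exact contDiff_convexTail.contDiffAt.comp p contDiffAt_snd

theorem hasDerivAt_mul_exp_div {x τ : ℝ → ℝ} {x' τ' s : ℝ} (hx : HasDerivAt x x' s)
    (hτ : HasDerivAt τ τ' s) (h0 : τ s ≠ 0) :
    HasDerivAt (fun r => τ r * Real.exp (x r / τ r))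
      (Real.exp (x s / τ s) * x' + Real.exp (x s / τ s) * (1 - x s / τ s) * τ') s := by
  refine (hτ.mul (hx.div hτ h0).exp).congr_deriv ?_
  simp only [Pi.div_apply]
  field_simp
  ring

theorem hasDerivAt_gaugeEq_comp (a : ι → E) (L : ℝ) {c : ℝ → E} {τ : ℝ → ℝ} {c' : E} {τ' s : ℝ}
    (hc : HasDerivAt c c' s) (hτ : HasDerivAt τ τ' s) (h0 : τ s ≠ 0) :
    HasDerivAt (fun r => gaugeEq a L (c r, τ r))
      (∑ i, Real.exp (inner ℝ (a i) (c s) / τ s) * inner ℝ (a i) c'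
        - gaugeSlope a L (c s, τ s) * τ') s := by
  have h1 : ∀ i, HasDerivAt (fun r => inner ℝ (a i) (c r)) (inner ℝ (a i) c') s := fun i => by
    simpa using (hasDerivAt_const s (a i)).inner ℝ hc
  have h2 := HasDerivAt.fun_sum fun i (_ : i ∈ Finset.univ) => hasDerivAt_mul_exp_div (h1 i) hτ h0
  refine ((h2.sub (hτ.const_mul L)).add ((hasDerivAt_convexTail (τ s)).comp s hτ)).congr_deriv ?_
  simp only [gaugeSlope, Finset.sum_add_distrib, sub_mul, Finset.sum_mul, add_mul]
  ring

theorem exp_mul_one_sub_le_one (x : ℝ) : Real.exp x * (1 - x) ≤ 1 := by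
  have h := Real.add_one_le_exp (-x)
  have h2 : Real.exp x * Real.exp (-x) = 1 := by rw [← Real.exp_add]; simp
  nlinarith [Real.exp_pos x]

/-- Each term `exp x * (1 - x)` is at most 1, whatever `u` is. This is why `L` must exceed the
number of vectors: `gaugeEq` then decreases in `t` at a uniform rate. -/
theorem gaugeSlope_lower (a : ι → E) (L : ℝ) (p : E × ℝ) :
    L - Fintype.card ι ≤ gaugeSlope a L p := by
  have h : ∑ i, Real.exp (inner ℝ (a i) p.1 / p.2) * (1 - inner ℝ (a i) p.1 / p.2)
      ≤ ∑ _i : ι, (1 : ℝ) := Finset.sum_le_sum fun i _ => exp_mul_one_sub_le_one _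
  simp only [Finset.sum_const, Finset.card_univ, nsmul_eq_mul, mul_one] at h
  unfold gaugeSlope
  linarith [Real.smoothTransition.nonneg (2 - p.2)]

variable (a : ι → E) {L : ℝ}

theorem gaugeSlope_pos (hL : Fintype.card ι < L) (p : E × ℝ) : 0 < gaugeSlope a L p :=
  (sub_pos.2 hL).trans_le (gaugeSlope_lower a L p)

theorem hasDerivAt_gaugeEq_snd (L : ℝ) (u : E) {t : ℝ} (ht : t ≠ 0) :
    HasDerivAt (fun r => gaugeEq a L (u, r)) (-gaugeSlope a L (u, t)) t := by
  simpa using hasDerivAt_gaugeEq_comp a L (hasDerivAt_const t u) (hasDerivAt_id t) ht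

theorem strictAntiOn_gaugeEq (hL : Fintype.card ι < L) (u : E) : StrictAntiOn (fun t => gaugeEq a L (u, t)) (Set.Ioi 0) := by
  refine strictAntiOn_of_deriv_neg (convex_Ioi 0) (fun t ht => ?_) fun t ht => ?_
  · exact (hasDerivAt_gaugeEq_snd a L u (ne_of_gt ht)).continuousAt.continuousWithinAt
  · rw [interior_Ioi] at ht
    rw [(hasDerivAt_gaugeEq_snd a L u (ne_of_gt ht)).deriv]
    exact neg_neg_of_pos (gaugeSlope_pos a hL _)

theorem gaugeEq_le_linear (L : ℝ) (u : E) {s t : ℝ} (hs : 0 < s) (hst : s ≤ t) :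
    gaugeEq a L (u, t) ≤ gaugeEq a L (u, s) - (L - Fintype.card ι) * (t - s) := by
  have hd : ∀ r ∈ Set.Ici s, HasDerivAt
      (fun r => gaugeEq a L (u, r) + (L - Fintype.card ι) * r)
      (-gaugeSlope a L (u, r) + (L - Fintype.card ι)) r := fun r hr =>
    ((hasDerivAt_gaugeEq_snd a L u (hs.trans_le hr).ne').add
      ((hasDerivAt_id r).const_mul (L - Fintype.card ι : ℝ))).congr_deriv (by rw [mul_one])
  have : AntitoneOn (fun r => gaugeEq a L (u, r) + (L - Fintype.card ι) * r) (Set.Ici s) := by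
    refine antitoneOn_of_deriv_nonpos (convex_Ici s)
      (fun r hr => (hd r hr).continuousAt.continuousWithinAt)
      (fun r hr => (hd r (interior_subset hr)).differentiableAt.differentiableWithinAt)
      fun r hr => ?_
    rw [(hd r (interior_subset hr)).deriv]
    linarith [gaugeSlope_lower a L (u, r)]
  have := this (Set.self_mem_Ici) hst hst
  simp only at this
  linarith

/-- Near `t = 0` the tail stays positive while `L t` tends to 0, and the exponential terms only
help. Without the tail there would be no positive root at `u = 0`. -/
theorem exists_pos_forall_gaugeEq_pos (a : ι → E) (L : ℝ) :
    ∃ t > 0, ∀ u : E, 0 < gaugeEq a L (u, t) := by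
  have hc : ContinuousAt (fun t => convexTail t - L * t) 0 :=
    (contDiff_convexTail.continuous.sub (by fun_prop)).continuousAt
  have h0 : ∀ᶠ t in 𝓝 (0 : ℝ), 0 < convexTail t - L * t :=
    hc.eventually (lt_mem_nhds (by simpa using convexTail_zero_pos))
  obtain ⟨t, ht, ht0⟩ := ((h0.filter_mono nhdsWithin_le_nhds).and
    (self_mem_nhdsWithin : Set.Ioi (0 : ℝ) ∈ 𝓝[>] 0)).exists
  refine ⟨t, ht0, fun u => ?_⟩
  have : 0 ≤ ∑ i, t * Real.exp (inner ℝ (a i) u / t) :=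
    Finset.sum_nonneg fun i _ => mul_nonneg (le_of_lt ht0) (Real.exp_pos _).le
  simp only [gaugeEq]
  linarith

theorem exists_gaugeEq_zero (hL : Fintype.card ι < L) (u : E) : ∃ t > 0, gaugeEq a L (u, t) = 0 := by
  obtain ⟨s, hs, hpos⟩ := exists_pos_forall_gaugeEq_pos a L
  have hLN : 0 < L - Fintype.card ι := sub_pos.2 hL
  set t := s + gaugeEq a L (u, s) / (L - Fintype.card ι) with ht
  have hst : s ≤ t := by have := div_nonneg (hpos u).le hLN.le; linarith
  have h1 : gaugeEq a L (u, t) ≤ 0 := by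
    have := gaugeEq_le_linear a L u hs hst
    rw [ht, add_sub_cancel_left, mul_div_cancel₀ _ hLN.ne', sub_self] at this
    exact this
  obtain ⟨r, hr, hr0⟩ := intermediate_value_Icc' hst (f := fun t => gaugeEq a L (u, t))
    (fun r hr => (hasDerivAt_gaugeEq_snd a L u (hs.trans_le hr.1).ne').continuousAt.continuousWithinAt)
    (Set.mem_Icc.2 ⟨h1, (hpos u).le⟩)
  exact ⟨r, hs.trans_le hr.1, hr0⟩

/-- The smoothed gauge: the positive solution `t` of `gaugeEq a L (u, t) = 0`. -/
def smoothGauge (hL : Fintype.card ι < L) (u : E) : ℝ := (exists_gaugeEq_zero a hL u).choose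

theorem smoothGauge_pos (hL : Fintype.card ι < L) (u : E) : 0 < smoothGauge a hL u :=
  (exists_gaugeEq_zero a hL u).choose_spec.1

theorem gaugeEq_smoothGauge (hL : Fintype.card ι < L) (u : E) : gaugeEq a L (u, smoothGauge a hL u) = 0 :=
  (exists_gaugeEq_zero a hL u).choose_spec.2

theorem smoothGauge_eq (hL : Fintype.card ι < L) {u : E} {t : ℝ} (ht : 0 < t) (h : gaugeEq a L (u, t) = 0) :
    smoothGauge a hL u = t :=
  (strictAntiOn_gaugeEq a hL u).injOn (smoothGauge_pos a hL u) ht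
    ((gaugeEq_smoothGauge a hL u).trans h.symm)

theorem fderiv_gaugeEq_snd (L : ℝ) (u : E) {t : ℝ} (ht : t ≠ 0) :
    fderiv ℝ (gaugeEq a L) (u, t) (0, 1) = -gaugeSlope a L (u, t) := by
  have h1 := ((contDiffAt_gaugeEq a L (p := (u, t)) ht).differentiableAt (by simp)).hasFDerivAt
  have h2 : HasDerivAt (fun r : ℝ => (u, r)) ((0 : E), (1 : ℝ)) t :=
    (hasDerivAt_const t u).prodMk (hasDerivAt_id t)
  exact (h1.comp_hasDerivAt t h2).unique (hasDerivAt_gaugeEq_snd a L u ht)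

/-- The slope in `t` is nonzero, so the implicit function theorem applies; uniqueness of the
positive root identifies the local solution with the gauge. -/
theorem contDiff_smoothGauge (hL : Fintype.card ι < L) [CompleteSpace E] : ContDiff ℝ ∞ (smoothGauge a hL) := by
  rw [contDiff_iff_contDiffAt]
  intro u
  set t := smoothGauge a hL u with ht
  have ht0 : 0 < t := smoothGauge_pos a hL u
  have cdf := contDiffAt_gaugeEq a L (p := (u, t)) ht0.ne'
  have hinv : (fderiv ℝ (gaugeEq a L) (u, t) ∘L .inr ℝ E ℝ).IsInvertible := by
    have hne : -gaugeSlope a L (u, t) ≠ 0 := (neg_neg_of_pos (gaugeSlope_pos a hL _)).ne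
    refine ⟨ContinuousLinearEquiv.unitsEquivAut ℝ (Units.mk0 _ hne), ?_⟩
    ext
    simp [fderiv_gaugeEq_snd a L u ht0.ne']
  have hpn : (∞ : WithTop ℕ∞) ≠ 0 := by simp
  have hs := cdf.contDiffAt_implicitFunction hpn hinv
  refine hs.congr_of_eventuallyEq ?_
  have hpos : ∀ᶠ x in 𝓝 u, 0 < cdf.implicitFunction hpn hinv x := by
    refine hs.continuousAt.eventually (lt_mem_nhds ?_)
    rw [cdf.implicitFunction_apply_self hpn hinv]
    exact ht0
  filter_upwards [hpos, cdf.eventually_apply_implicitFunction hpn hinv] with x hx hx2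
  exact smoothGauge_eq a hL hx (hx2.trans (gaugeEq_smoothGauge a hL u))

end Gauge

/-! ### Homogeneity, convexity and growth of the radial potential -/

section Potential

variable {ι E : Type*} [Fintype ι] [NormedAddCommGroup E] [InnerProductSpace ℝ E]
  (a : ι → E) {L : ℝ}

theorem sum_exp_smoothGauge_le (hL : Fintype.card ι < L) (u : E) :
    ∑ i, Real.exp (inner ℝ (a i) u / smoothGauge a hL u) ≤ L := by
  have h := gaugeEq_smoothGauge a hL u
  have hT := smoothGauge_pos a hL u
  simp only [gaugeEq, ← Finset.mul_sum] at h
  have := convexTail_nonneg (smoothGauge a hL u)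
  by_contra! hlt
  nlinarith

theorem sum_exp_smoothGauge_eq (hL : Fintype.card ι < L) {u : E} (hu : 2 ≤ smoothGauge a hL u) :
    ∑ i, Real.exp (inner ℝ (a i) u / smoothGauge a hL u) = L := by
  have h := gaugeEq_smoothGauge a hL u
  have hT := smoothGauge_pos a hL u
  simp only [gaugeEq, ← Finset.mul_sum, convexTail_of_two_le hu] at h
  exact mul_left_cancel₀ hT.ne' (by linarith)

theorem smoothGauge_smul_of_one_le (hL : Fintype.card ι < L) {u : E}
    (hu : 2 ≤ smoothGauge a hL u) {t : ℝ} (ht : 1 ≤ t) :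
    smoothGauge a hL (t • u) = t * smoothGauge a hL u := by
  have h0 : 0 < t := by linarith
  have hT := smoothGauge_pos a hL u
  refine smoothGauge_eq a hL (by positivity) ?_
  simp only [gaugeEq, ← Finset.mul_sum, inner_smul_right, mul_div_mul_left _ _ h0.ne',
    sum_exp_smoothGauge_eq a hL hu, convexTail_of_two_le (hu.trans (le_mul_of_one_le_left hT.le ht))]
  ring

theorem smoothGauge_smul (hL : Fintype.card ι < L) {u : E} {t : ℝ} (ht : 0 < t)
    (hu : 2 ≤ smoothGauge a hL u) (htu : 2 ≤ smoothGauge a hL (t • u)) :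
    smoothGauge a hL (t • u) = t * smoothGauge a hL u := by
  rcases le_total 1 t with h | h
  · exact smoothGauge_smul_of_one_le a hL hu h
  · have := smoothGauge_smul_of_one_le a hL htu (one_le_inv_iff₀.2 ⟨ht, h⟩)
    rw [smul_smul, inv_mul_cancel₀ ht.ne', one_smul] at this
    rw [this, mul_inv_cancel_left₀ ht.ne']

theorem hasDerivAt_comp_line {F : Type*} [NormedAddCommGroup F] [NormedSpace ℝ F] {g : E → F}
    {u v : E} {s : ℝ} (hg : DifferentiableAt ℝ g (u + s • v)) :
    HasDerivAt (fun r : ℝ => g (u + r • v)) (fderiv ℝ g (u + s • v) v) s := by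
  have hl : HasDerivAt (fun r : ℝ => u + r • v) v s := by
    simpa using ((hasDerivAt_id s).smul_const v).const_add u
  exact HasFDerivAt.comp_hasDerivAt (f := fun r : ℝ => u + r • v) s hg.hasFDerivAt hl

theorem gaugeSlope_mul_deriv [CompleteSpace E] (hL : Fintype.card ι < L) (u v : E) :
    gaugeSlope a L (u, smoothGauge a hL u) * fderiv ℝ (smoothGauge a hL) u v =
      ∑ i, Real.exp (inner ℝ (a i) u / smoothGauge a hL u) * inner ℝ (a i) v := by
  have hl : HasDerivAt (fun s : ℝ => u + s • v) v 0 := by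
    simpa using ((hasDerivAt_id (0 : ℝ)).smul_const v).const_add u
  have hτ := hasDerivAt_comp_line (v := v)
    ((contDiff_smoothGauge a hL).differentiable (by simp) (u + (0 : ℝ) • v))
  have h1 := hasDerivAt_gaugeEq_comp a L hl hτ (smoothGauge_pos a hL _).ne'
  simp only [gaugeEq_smoothGauge, zero_smul, add_zero] at h1
  have := h1.unique (hasDerivAt_const (0 : ℝ) (0 : ℝ))
  linarith

/-- This differentiates one term of the once-differentiated gauge equation along a line. The terms
without `ρ'` collect into a square, the source of convexity. -/
theorem exp_mul_hasDerivAt {b x₀ : ℝ} {τ ρ : ℝ → ℝ} {ρ' s : ℝ} (hτ : HasDerivAt τ (ρ s) s)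
    (hρ : HasDerivAt ρ ρ' s) (h0 : τ s ≠ 0) :
    HasDerivAt (fun r => Real.exp ((x₀ + r * b) / τ r) * (b + (1 - (x₀ + r * b) / τ r) * ρ r))
      (Real.exp ((x₀ + s * b) / τ s) * ((b - (x₀ + s * b) / τ s * ρ s) ^ 2 / τ s)
        + Real.exp ((x₀ + s * b) / τ s) * (1 - (x₀ + s * b) / τ s) * ρ') s := by
  have hx : HasDerivAt (fun r => x₀ + r * b) b s := by
    simpa using ((hasDerivAt_id s).mul_const b).const_add x₀
  have hy := hx.div hτ h0
  refine (hy.exp.mul (((hy.const_sub 1).mul hρ).const_add b)).congr_deriv ?_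
  simp only [Pi.div_apply, Pi.mul_apply]
  field_simp
  ring

/-- The radial potential of the smoothed gauge. -/
def gaugePotential (hL : Fintype.card ι < L) (u : E) : ℝ := smoothGauge a hL u ^ 2 / 2

theorem contDiff_gaugePotential [CompleteSpace E] (hL : Fintype.card ι < L) :
    ContDiff ℝ ∞ (gaugePotential a hL) :=
  ((contDiff_smoothGauge a hL).pow 2).div_const 2

theorem fderiv_gaugePotential [CompleteSpace E] (hL : Fintype.card ι < L) (u v : E) :
    fderiv ℝ (gaugePotential a hL) u v =
      smoothGauge a hL u * fderiv ℝ (smoothGauge a hL) u v := by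
  have hd := ((contDiff_smoothGauge a hL).differentiable (by simp) u).hasFDerivAt
  have h : HasFDerivAt (gaugePotential a hL)
      (smoothGauge a hL u • fderiv ℝ (smoothGauge a hL) u) u := by
    have := (hd.pow 2).mul_const (1 / 2)
    refine (this.congr_fderiv ?_).congr_of_eventuallyEq (.of_forall fun x => ?_)
    · ext w
      simp
      ring
    · simp only [gaugePotential]
      ring
  rw [h.fderiv]
  simp

theorem gradient_gaugePotential [CompleteSpace E] (hL : Fintype.card ι < L) (u : E) :
    gradient (gaugePotential a hL) u =
      (smoothGauge a hL u / gaugeSlope a L (u, smoothGauge a hL u)) •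
        ∑ i, Real.exp (inner ℝ (a i) u / smoothGauge a hL u) • a i := by
  refine ext_inner_right ℝ fun v => ?_
  rw [inner_gradient_left, fderiv_gaugePotential, inner_smul_left, sum_inner]
  simp only [inner_smul_left, RCLike.conj_to_real, ← gaugeSlope_mul_deriv a hL u v]
  have := (gaugeSlope_pos a hL (u, smoothGauge a hL u)).ne'
  field_simp

theorem gradient_gaugePotential_smul [CompleteSpace E] (hL : Fintype.card ι < L) {u : E} {t : ℝ}
    (ht : 0 < t) (hu : 2 ≤ smoothGauge a hL u) (htu : 2 ≤ smoothGauge a hL (t • u)) :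
    gradient (gaugePotential a hL) (t • u) = t • gradient (gaugePotential a hL) u := by
  have hs := smoothGauge_smul a hL ht hu htu
  simp only [gradient_gaugePotential, smul_smul, gaugeSlope]
  rw [Real.smoothTransition.zero_of_nonpos (sub_nonpos.2 hu),
    Real.smoothTransition.zero_of_nonpos (sub_nonpos.2 htu), hs]
  simp only [inner_smul_right, mul_div_mul_left _ _ ht.ne', mul_div_assoc]

/-- Along a line, `φ'' = ρ² + T ρ'` with `ρ = T'`. The second implicit derivative writes `ρ'` times
the positive slope as a sum of weighted squares plus a nonnegative contribution of the tail. If `ρ =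
0`, the squares reduce to `⟨a i, v⟩²`, which cannot all vanish. -/
theorem fderiv_fderiv_gaugePotential_pos [CompleteSpace E] (hL : Fintype.card ι < L)
    (ha : ∀ v : E, (∀ i, inner ℝ (a i) v = 0) → v = 0) (u : E) {v : E} (hv : v ≠ 0) :
    0 < fderiv ℝ (fderiv ℝ (gaugePotential a hL)) u v v := by
  set T := smoothGauge a hL with hTdef
  have hT := contDiff_smoothGauge a hL
  have hT' : ContDiff ℝ ∞ (fderiv ℝ T) := (contDiff_infty_iff_fderiv.1 hT).2
  set τ : ℝ → ℝ := fun s => T (u + s • v) with hτdef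
  set ρ : ℝ → ℝ := fun s => fderiv ℝ T (u + s • v) v with hρdef
  have hτ : HasDerivAt τ (ρ 0) 0 :=
    hasDerivAt_comp_line (hT.differentiable (by simp) _)
  have hρd : DifferentiableAt ℝ ρ 0 :=
    (hasDerivAt_comp_line (hT'.differentiable (by simp) _)).differentiableAt.clm_apply
      (differentiableAt_const v)
  have hρ := hρd.hasDerivAt
  set ρ' := deriv ρ 0
  have hτ0 : 0 < τ 0 := smoothGauge_pos a hL _
  have heq : ∀ s, ∑ i, Real.exp ((inner ℝ (a i) u + s * inner ℝ (a i) v) / τ s) *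
      (inner ℝ (a i) v + (1 - (inner ℝ (a i) u + s * inner ℝ (a i) v) / τ s) * ρ s)
        - (L + Real.smoothTransition (2 - τ s)) * ρ s = 0 := fun s => by
    have h := gaugeSlope_mul_deriv a hL (u + s • v) v
    simp only [gaugeSlope, inner_add_right, inner_smul_right] at h
    simp only [mul_add, Finset.sum_add_distrib, ← mul_assoc, ← Finset.sum_mul]
    simp only [hτdef, hρdef, hTdef]
    rw [← h]
    ring
  have hst : HasDerivAt (fun s => Real.smoothTransition (2 - τ s))
      (deriv Real.smoothTransition (2 - τ 0) * (-ρ 0)) 0 :=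
    HasDerivAt.comp (h := fun s => 2 - τ s) 0 (((Real.smoothTransition.contDiff
      (n := 1)).differentiable (by simp) (2 - τ 0)).hasDerivAt) (hτ.const_sub 2)
  have hsum := (HasDerivAt.fun_sum fun i (_ : i ∈ Finset.univ) =>
    exp_mul_hasDerivAt (b := inner ℝ (a i) v) (x₀ := inner ℝ (a i) u) hτ hρ hτ0.ne').sub
      ((hst.const_add L).mul hρ)
  have hzero := (hsum.congr_of_eventuallyEq
    (f₁ := fun _ => (0 : ℝ)) (.of_forall fun s => (heq s).symm)).unique (hasDerivAt_const _ _)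
  have hslope := gaugeSlope_pos a hL (u, T u)
  have hst0 : 0 ≤ deriv Real.smoothTransition (2 - τ 0) :=
    Real.smoothTransition.monotone.deriv_nonneg
  have hτu : τ 0 = T u := by simp [hτdef]
  simp only [zero_mul, add_zero, Finset.sum_add_distrib, ← Finset.sum_mul] at hzero
  have hterm : ∀ i ∈ Finset.univ, 0 ≤ Real.exp (inner ℝ (a i) u / τ 0) *
      ((inner ℝ (a i) v - inner ℝ (a i) u / τ 0 * ρ 0) ^ 2 / τ 0) := fun i _ => by positivity
  have hkey : gaugeSlope a L (u, T u) * ρ' =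
      ∑ i, Real.exp (inner ℝ (a i) u / τ 0) *
        ((inner ℝ (a i) v - inner ℝ (a i) u / τ 0 * ρ 0) ^ 2 / τ 0)
        + deriv Real.smoothTransition (2 - τ 0) * ρ 0 ^ 2 := by
    simp only [gaugeSlope, ← hτu]
    linarith
  have hρ'0 : 0 ≤ ρ' := by
    have := add_nonneg (Finset.sum_nonneg hterm) (mul_nonneg hst0 (sq_nonneg (ρ 0)))
    rw [← hkey] at this
    exact nonneg_of_mul_nonneg_right this hslope
  have hsecond : fderiv ℝ (fderiv ℝ (gaugePotential a hL)) u v v = ρ 0 * ρ 0 + τ 0 * ρ' := by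
    have hφ' : ContDiff ℝ ∞ (fderiv ℝ (gaugePotential a hL)) :=
      (contDiff_infty_iff_fderiv.1 (contDiff_gaugePotential a hL)).2
    have h1 := (hasDerivAt_comp_line (v := v) ((hφ'.differentiable (by simp))
      (u + (0 : ℝ) • v))).clm_apply (hasDerivAt_const 0 v)
    have h2 := (hτ.mul hρ).congr_of_eventuallyEq (f₁ := fun s : ℝ =>
      fderiv ℝ (gaugePotential a hL) (u + s • v) v)
      (.of_forall fun s => fderiv_gaugePotential a hL (u + s • v) v)
    simpa using h1.unique h2
  rw [hsecond]
  rcases eq_or_ne (ρ 0) 0 with h0 | h0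
  · have hpos : 0 < ρ' := by
      refine lt_of_le_of_ne hρ'0 fun h => hv (ha v fun i => ?_)
      rw [← h, h0] at hkey
      simp only [mul_zero, sub_zero, ne_eq, OfNat.ofNat_ne_zero, not_false_eq_true, zero_pow,
        add_zero] at hkey
      have := (Finset.sum_eq_zero_iff_of_nonneg (fun i _ => by positivity)).1 hkey.symm i
        (Finset.mem_univ i)
      simpa [hτ0.ne'] using this
    rw [h0]
    positivity
  · have := mul_self_pos.2 h0
    positivity

/-- The right-hand sum is positively homogeneous, and positive and continuous on the unit sphere,
which is compact. -/
theorem exists_norm_le_sum_max [FiniteDimensional ℝ E]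
    (ha : ∀ v : E, v ≠ 0 → ∃ i, 0 < inner ℝ (a i) v) :
    ∃ C > 0, ∀ u : E, ‖u‖ ≤ C * ∑ i, max 0 (inner ℝ (a i) u) := by
  have hc : Continuous fun u : E => ∑ i, max 0 (inner ℝ (a i) u) := by fun_prop
  obtain ⟨c, hc0, hcm⟩ := (isCompact_sphere (0 : E) 1).exists_forall_le' hc.continuousOn (a := 0)
    fun u hu => by
      have hu0 : u ≠ 0 := fun h => by simp [h] at hu
      obtain ⟨i, hi⟩ := ha u hu0
      exact Finset.sum_pos' (fun j _ => le_max_left _ _) ⟨i, Finset.mem_univ i, lt_max_of_lt_right hi⟩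
  refine ⟨c⁻¹, inv_pos.2 hc0, fun u => ?_⟩
  rcases eq_or_ne u 0 with rfl | hu
  · simp
  · have hn : 0 < ‖u‖ := norm_pos_iff.2 hu
    have h := hcm (‖u‖⁻¹ • u) (by simp [norm_smul, hn.ne'])
    have h2 : ∑ i, max 0 (inner ℝ (a i) (‖u‖⁻¹ • u)) = ‖u‖⁻¹ * ∑ i, max 0 (inner ℝ (a i) u) := by
      rw [Finset.mul_sum]
      refine Finset.sum_congr rfl fun i _ => ?_
      rw [inner_smul_right, mul_max_of_nonneg _ _ (inv_nonneg.2 hn.le), mul_zero]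
    rw [h2, le_inv_mul_iff₀ hn] at h
    rw [le_inv_mul_iff₀ hc0]
    linarith

theorem exists_norm_le_smoothGauge [FiniteDimensional ℝ E] (hL : Fintype.card ι < L)
    (ha : ∀ v : E, v ≠ 0 → ∃ i, 0 < inner ℝ (a i) v) :
    ∃ C > 0, ∀ u : E, ‖u‖ ≤ C * smoothGauge a hL u := by
  obtain ⟨C, hC, h⟩ := exists_norm_le_sum_max a ha
  -- Each exponential is at most `L`, so each `⟨a i, u⟩` is at most `T log L`; the extra 1 only
  -- keeps the constant positive.
  refine ⟨C * (Fintype.card ι * |Real.log L|) + 1, by positivity, fun u => ?_⟩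
  have hT := smoothGauge_pos a hL u
  have hle : ∑ i, max 0 (inner ℝ (a i) u) ≤ ∑ _i : ι, smoothGauge a hL u * |Real.log L| := by
    refine Finset.sum_le_sum fun i _ => max_le (by positivity) ?_
    have h1 : Real.exp (inner ℝ (a i) u / smoothGauge a hL u) ≤ L :=
      (Finset.single_le_sum (f := fun i => Real.exp (inner ℝ (a i) u / smoothGauge a hL u))
        (fun i _ => (Real.exp_pos _).le) (Finset.mem_univ i)).trans (sum_exp_smoothGauge_le a hL u)
    have h2 := (Real.le_log_iff_exp_le ((Real.exp_pos _).trans_le h1)).2 h1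
    rw [div_le_iff₀' hT] at h2
    exact h2.trans (mul_le_mul_of_nonneg_left (le_abs_self _) hT.le)
  rw [Finset.sum_const, Finset.card_univ, nsmul_eq_mul] at hle
  have := mul_le_mul_of_nonneg_left hle hC.le
  linarith [h u]

end Potential

/-! ### Gradient maps of functions with positive Hessian -/

section PosHessian

variable {E : Type*} [NormedAddCommGroup E] [InnerProductSpace ℝ E] {φ : E → ℝ}

theorem hasDerivAt_line (hφ : ContDiff ℝ ∞ φ) (u v : E) (s : ℝ) :
    HasDerivAt (fun r : ℝ => φ (u + r • v)) (fderiv ℝ φ (u + s • v) v) s :=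
  hasDerivAt_comp_line (hφ.differentiable (by simp) _)

theorem hasDerivAt_fderiv_line (hφ : ContDiff ℝ ∞ φ) (u v : E) (s : ℝ) :
    HasDerivAt (fun r : ℝ => fderiv ℝ φ (u + r • v) v)
      (fderiv ℝ (fderiv ℝ φ) (u + s • v) v v) s := by
  have hφ' : ContDiff ℝ ∞ (fderiv ℝ φ) := (contDiff_infty_iff_fderiv.1 hφ).2
  simpa using (hasDerivAt_comp_line (v := v) ((hφ'.differentiable (by simp))
    (u + s • v))).clm_apply (hasDerivAt_const s v)

variable (hφ : ContDiff ℝ ∞ φ) (hpos : ∀ u v : E, v ≠ 0 → 0 < fderiv ℝ (fderiv ℝ φ) u v v)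

include hφ hpos

theorem strictMono_fderiv_line (u : E) {v : E} (hv : v ≠ 0) :
    StrictMono fun r : ℝ => fderiv ℝ φ (u + r • v) v :=
  strictMono_of_deriv_pos fun s => by
    rw [(hasDerivAt_fderiv_line hφ u v s).deriv]
    exact hpos _ v hv

theorem strictConvexOn_univ_of_hessian_pos : StrictConvexOn ℝ Set.univ φ := by
  refine ⟨convex_univ, fun x _ y _ hxy p q hp hq hpq => ?_⟩
  have hv : y - x ≠ 0 := sub_ne_zero.2 hxy.symm
  have hd : deriv (fun r : ℝ => φ (x + r • (y - x))) =
      fun r => fderiv ℝ φ (x + r • (y - x)) (y - x) :=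
    funext fun s => (hasDerivAt_line hφ x (y - x) s).deriv
  have hg : StrictConvexOn ℝ Set.univ fun r : ℝ => φ (x + r • (y - x)) := by
    refine StrictMono.strictConvexOn_univ_of_deriv ?_ ?_
    · exact continuous_iff_continuousAt.2 fun s => (hasDerivAt_line hφ x (y - x) s).continuousAt
    · rw [hd]
      exact strictMono_fderiv_line hφ hpos x hv
  have := hg.2 (Set.mem_univ 0) (Set.mem_univ 1) zero_ne_one hp hq hpq
  have he : x + q • (y - x) = p • x + q • y := by
    rw [← eq_sub_iff_add_eq] at hpq
    rw [hpq]
    module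
  simpa [he] using this

theorem gradient_injective_of_hessian_pos [CompleteSpace E] :
    Function.Injective (gradient φ) := by
  intro x y h
  by_contra hxy
  have hv : y - x ≠ 0 := sub_ne_zero.2 (Ne.symm hxy)
  have := strictMono_fderiv_line hφ hpos x hv zero_lt_one
  simp only [zero_smul, add_zero, one_smul, add_sub_cancel, ← inner_gradient_left, h] at this
  exact lt_irrefl _ this

/-- By the mean value theorem the left side is the radial derivative at an intermediate point, and
radial derivatives increase. -/
theorem sub_le_inner_gradient [CompleteSpace E] (u : E) :
    φ u - φ 0 ≤ inner ℝ (gradient φ u) u := by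
  rcases eq_or_ne u 0 with rfl | hu
  · simp
  obtain ⟨s, hs, hsl⟩ := exists_hasDerivAt_eq_slope (fun r : ℝ => φ (0 + r • u)) _ zero_lt_one
    (fun s _ => (hasDerivAt_line hφ 0 u s).continuousAt.continuousWithinAt)
    fun s _ => hasDerivAt_line hφ 0 u s
  have := strictMono_fderiv_line hφ hpos 0 hu hs.2
  simp only [zero_add, one_smul, zero_smul, sub_zero, div_one] at this hsl
  rw [inner_gradient_left, ← hsl]
  exact this.le

theorem norm_mul_sub_le_norm_gradient [CompleteSpace E] {c : ℝ}
    (hcoer : ∀ u, c * ‖u‖ ^ 2 ≤ φ u) {u : E} (hu : 1 ≤ ‖u‖) :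
    c * ‖u‖ - |φ 0| ≤ ‖gradient φ u‖ := by
  have h1 := sub_le_inner_gradient hφ hpos u
  have h2 := real_inner_le_norm (gradient φ u) u
  have h3 := hcoer u
  have h4 := le_abs_self (φ 0)
  have h5 : 0 ≤ |φ 0| * (‖u‖ - 1) := mul_nonneg (abs_nonneg _) (by linarith)
  refine le_of_mul_le_mul_right ?_ (by linarith : 0 < ‖u‖)
  nlinarith

theorem tendsto_gradient_cocompact [FiniteDimensional ℝ E] {c : ℝ} (hc : 0 < c)
    (hcoer : ∀ u, c * ‖u‖ ^ 2 ≤ φ u) :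
    Tendsto (gradient φ) (cocompact E) (cocompact E) := by
  rw [← Metric.cobounded_eq_cocompact, ← tendsto_norm_atTop_iff_cobounded]
  have h : Tendsto (fun u : E => c * ‖u‖ - |φ 0|) (Bornology.cobounded E) atTop :=
    tendsto_atTop_add_const_right _ _ (tendsto_norm_cobounded_atTop.const_mul_atTop hc)
  refine tendsto_atTop_mono' _ ?_ h
  filter_upwards [tendsto_norm_cobounded_atTop.eventually_ge_atTop 1] with u hu
  exact norm_mul_sub_le_norm_gradient hφ hpos hcoer hu

end PosHessian

theorem continuous_gradient {E : Type*} [NormedAddCommGroup E] [InnerProductSpace ℝ E]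
    [CompleteSpace E] {φ : E → ℝ} (hφ : ContDiff ℝ ∞ φ) : Continuous (gradient φ) :=
  (InnerProductSpace.toDual ℝ E).symm.continuous.comp (contDiff_infty_iff_fderiv.1 hφ).2.continuous

/-- Quadratic growth gives `φ - ⟨p, ·⟩` a minimum, where the gradient of `φ` is `p`. -/
theorem gradient_surjective_of_coercive {E : Type*} [NormedAddCommGroup E]
    [InnerProductSpace ℝ E] [FiniteDimensional ℝ E] {φ : E → ℝ} (hφ : Differentiable ℝ φ)
    {c : ℝ} (hc : 0 < c) (hcoer : ∀ u, c * ‖u‖ ^ 2 ≤ φ u) : Function.Surjective (gradient φ) := by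
  intro p
  have hcont : Continuous fun u => φ u - inner ℝ p u :=
    hφ.continuous.sub (continuous_const.inner continuous_id)
  have hlim : Tendsto (fun u => φ u - inner ℝ p u) (cocompact E) atTop := by
    have h : Tendsto (fun u : E => ‖u‖) (cocompact E) atTop := tendsto_norm_cocompact_atTop
    refine tendsto_atTop_mono' _ ?_ h
    filter_upwards [h.eventually_ge_atTop ((‖p‖ + 1) / c)] with u hu
    rw [div_le_iff₀ hc] at hu
    have h1 := hcoer u
    have h2 := real_inner_le_norm p u
    have h3 := mul_le_mul_of_nonneg_right hu (norm_nonneg u)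
    nlinarith
  obtain ⟨u, hu⟩ := hcont.exists_forall_le hlim
  refine ⟨u, ?_⟩
  have hd : HasFDerivAt (fun u => φ u - inner ℝ p u) (fderiv ℝ φ u - innerSL ℝ p) u :=
    (hφ u).hasFDerivAt.sub (innerSL ℝ p).hasFDerivAt
  have h0 := IsLocalMin.hasFDerivAt_eq_zero (.of_forall hu) hd
  refine ext_inner_right ℝ fun v => ?_
  rw [inner_gradient_left]
  have := DFunLike.congr_fun h0 v
  simp only [sub_apply, innerSL_apply_apply, zero_apply] at this
  linarith

theorem isClosedMap_gradient {E : Type*} [NormedAddCommGroup E]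
    [InnerProductSpace ℝ E] [FiniteDimensional ℝ E] {φ : E → ℝ} (hφ : ContDiff ℝ ∞ φ)
    (hpos : ∀ u v : E, v ≠ 0 → 0 < fderiv ℝ (fderiv ℝ φ) u v v)
    {c : ℝ} (hc : 0 < c) (hcoer : ∀ u, c * ‖u‖ ^ 2 ≤ φ u) : IsClosedMap (gradient φ) :=
  (isProperMap_iff_tendsto_cocompact.2
    ⟨continuous_gradient hφ, tendsto_gradient_cocompact hφ hpos hc hcoer⟩).isClosedMap

/-! ### The Kähler form of a potential on the complex torus -/

section TorusForm

variable {n : ℕ}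

theorem isOpen_torus : IsOpen (torus n) := by
  have : torus n = ⋂ i, {z : Fin n → ℂ | z i ≠ 0} := by ext; simp [torus]
  rw [this]
  exact isOpen_iInter_of_finite fun i => isOpen_ne_fun (continuous_apply i) continuous_const

theorem hasFDerivAt_log_norm {z : ℂ} (hz : z ≠ 0) :
    HasFDerivAt (fun y : ℂ => Real.log ‖y‖) (Complex.reCLM ∘L (z⁻¹ • .id ℝ ℂ)) z := by
  -- Dividing by `z` moves the base point to 1, away from the branch cut of the logarithm.
  have h1 : HasDerivAt (fun y : ℂ => Complex.log (y / z)) z⁻¹ z := by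
    have := ((hasDerivAt_id z).div_const z).clog (x := z) (by simp [hz])
    simpa [hz] using this
  have h2 := (Complex.reCLM.hasFDerivAt.comp z (h1.hasFDerivAt.restrictScalars ℝ)).const_add
    (Real.log ‖z‖)
  refine (h2.congr_fderiv ?_).congr_of_eventuallyEq ?_
  · ext v
    simp
    ring
  · filter_upwards [isOpen_ne.mem_nhds hz] with y hy
    simp [Complex.log_re, Real.log_div, hz, hy]

/-- The derivative of `Log` at `z`. -/
def dLog (z : Fin n → ℂ) : (Fin n → ℂ) →L[ℝ] EuclideanSpace ℝ (Fin n) :=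
  (EuclideanSpace.equiv (Fin n) ℝ).symm.toContinuousLinearMap ∘L
    .pi fun i => (Complex.reCLM ∘L ((z i)⁻¹ • .id ℝ ℂ)) ∘L .proj i

theorem dLog_apply (z v : Fin n → ℂ) (i : Fin n) : dLog z v i = (v i / z i).re := by
  simp [dLog, div_eq_inv_mul]

/-- The derivative of the vector of arguments at `z`. -/
def dArg (z v : Fin n → ℂ) : EuclideanSpace ℝ (Fin n) := WithLp.toLp 2 fun j => dTheta j z v

theorem dArg_apply (z v : Fin n → ℂ) (i : Fin n) : dArg z v i = (v i / z i).im := rfl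

theorem hasFDerivAt_Log {z : Fin n → ℂ} (hz : z ∈ torus n) : HasFDerivAt Log (dLog z) z := by
  rw [← hasFDerivWithinAt_univ, hasFDerivWithinAt_euclidean]
  intro i
  rw [hasFDerivWithinAt_univ]
  have := (hasFDerivAt_log_norm (hz i)).comp z (ContinuousLinearMap.proj (R := ℝ)
    (φ := fun _ : Fin n => ℂ) i).hasFDerivAt
  refine this.congr_fderiv ?_
  ext v
  simp [dLog]

theorem contDiffOn_Log : ContDiffOn ℝ ∞ (Log (n := n)) (torus n) := by
  intro z hz
  refine ContDiffAt.contDiffWithinAt ?_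
  rw [contDiffAt_euclidean]
  intro i
  exact ((contDiff_apply ℝ ℂ i).contDiffAt.norm ℝ (hz i)).log (norm_ne_zero_iff.2 (hz i))

theorem dLog_I_smul (z v : Fin n → ℂ) : dLog z (Complex.I • v) = -dArg z v := by
  ext i
  simp [dLog_apply, dArg_apply, mul_div_assoc]

theorem dArg_I_smul (z v : Fin n → ℂ) : dArg z (Complex.I • v) = dLog z v := by
  ext i
  simp [dLog_apply, dArg_apply, mul_div_assoc]

theorem dLog_rotationField {z : Fin n → ℂ} (hz : z ∈ torus n) (j : Fin n) :
    dLog z (rotationField j z) = 0 := by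
  ext i
  rcases eq_or_ne i j with rfl | h
  · simp [dLog_apply, rotationField, hz i]
  · simp [dLog_apply, rotationField, h]

theorem dArg_rotationField {z : Fin n → ℂ} (hz : z ∈ torus n) (j : Fin n) :
    dArg z (rotationField j z) = EuclideanSpace.single j 1 := by
  ext i
  rcases eq_or_ne i j with rfl | h
  · simp [dArg_apply, rotationField, hz i]
  · simp [dArg_apply, rotationField, h]

theorem eq_zero_of_dLog_dArg {z v : Fin n → ℂ} (hz : z ∈ torus n) (h1 : dLog z v = 0)
    (h2 : dArg z v = 0) : v = 0 := by
  ext1 i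
  have hr : (v i / z i).re = 0 := by rw [← dLog_apply, h1]; rfl
  have hi : (v i / z i).im = 0 := by rw [← dArg_apply, h2]; rfl
  exact (div_eq_zero_iff.1 (Complex.ext hr hi)).resolve_right (hz i)

theorem Log_mul {t : Fin n → ℂ} (ht : ∀ i, ‖t i‖ = 1) (z : Fin n → ℂ) : Log (t * z) = Log z := by
  ext i
  simp [Log, ht i]

theorem dLog_mul {t : Fin n → ℂ} (ht : ∀ i, ‖t i‖ = 1) (z v : Fin n → ℂ) :
    dLog (t * z) (t * v) = dLog z v := by
  ext i
  have : t i ≠ 0 := norm_ne_zero_iff.1 (by simp [ht i])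
  simp [dLog_apply, mul_div_mul_left _ _ this]

theorem dArg_mul {t : Fin n → ℂ} (ht : ∀ i, ‖t i‖ = 1) (z v : Fin n → ℂ) :
    dArg (t * z) (t * v) = dArg z v := by
  ext i
  have : t i ≠ 0 := norm_ne_zero_iff.1 (by simp [ht i])
  simp [dArg_apply, mul_div_mul_left _ _ this]

variable {φ : EuclideanSpace ℝ (Fin n) → ℝ}

theorem gradient_apply (u : EuclideanSpace ℝ (Fin n)) (j : Fin n) :
    gradient φ u j = fderiv ℝ φ u (EuclideanSpace.single j 1) := by
  rw [← inner_gradient_left, EuclideanSpace.inner_single_right]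
  simp

theorem hasFDerivAt_gradient_Log (hφ : ContDiff ℝ ∞ φ) {z : Fin n → ℂ} (hz : z ∈ torus n)
    (j : Fin n) : HasFDerivAt (fun y => gradient φ (Log y) j)
      ((fderiv ℝ (fderiv ℝ φ) (Log z)).flip (EuclideanSpace.single j 1) ∘L dLog z) z := by
  have hφ' : ContDiff ℝ ∞ (fderiv ℝ φ) := (contDiff_infty_iff_fderiv.1 hφ).2
  have h := ((hφ'.differentiable (by simp) (Log z)).hasFDerivAt.comp z (hasFDerivAt_Log hz)).clm_apply
    (hasFDerivAt_const (EuclideanSpace.single j (1 : ℝ)) z)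
  simp only [gradient_apply]
  refine h.congr_fderiv ?_
  ext v
  simp

theorem fderiv_gradient_Log (hφ : ContDiff ℝ ∞ φ) {z : Fin n → ℂ} (hz : z ∈ torus n)
    (j : Fin n) (v : Fin n → ℂ) : fderiv ℝ (fun y => gradient φ (Log y) j) z v =
      fderiv ℝ (fderiv ℝ φ) (Log z) (dLog z v) (EuclideanSpace.single j 1) := by
  rw [(hasFDerivAt_gradient_Log hφ hz j).fderiv]
  simp

theorem sum_fderiv_gradient_mul_dTheta (hφ : ContDiff ℝ ∞ φ) {z : Fin n → ℂ} (hz : z ∈ torus n)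
    (v w : Fin n → ℂ) :
    ∑ j, fderiv ℝ (fun y => gradient φ (Log y) j) z v * dTheta j z w =
      fderiv ℝ (fderiv ℝ φ) (Log z) (dLog z v) (dArg z w) := by
  have h : dArg z w = ∑ j, dTheta j z w • EuclideanSpace.single j (1 : ℝ) := by
    ext i
    simp [dArg, Finset.sum_apply, Pi.single_apply]
  rw [h, map_sum]
  refine Finset.sum_congr rfl fun j _ => ?_
  rw [fderiv_gradient_Log hφ hz, map_smul, smul_eq_mul, mul_comm]

/-- The `1`-form `dθ_j` as a continuous linear functional. -/
def dThetaL (j : Fin n) (z : Fin n → ℂ) : (Fin n → ℂ) →L[ℝ] ℝ :=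
  Complex.imCLM ∘L ((z j)⁻¹ • .proj j)

theorem dThetaL_apply (j : Fin n) (z v : Fin n → ℂ) : dThetaL j z v = (v j / z j).im := by
  simp [dThetaL, div_eq_inv_mul]

/-- The `1`-form `∑_j (∂φ/∂u_j) dθ_j`. -/
def actionAngleForm (φ : EuclideanSpace ℝ (Fin n) → ℝ) (z : Fin n → ℂ) :
    (Fin n → ℂ) →L[ℝ] ℝ := ∑ j, gradient φ (Log z) j • dThetaL j z

theorem contDiffAt_dThetaL (j : Fin n) {z : Fin n → ℂ} (hz : z ∈ torus n) :
    ContDiffAt ℝ ∞ (dThetaL j) z := by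
  have h : ContDiffAt ℝ ∞ (fun y : Fin n → ℂ => (y j)⁻¹) z := (contDiff_apply ℝ ℂ j).contDiffAt.inv (hz j)
  exact contDiffAt_const.clm_comp (h.smul contDiffAt_const)

theorem contDiffAt_actionAngleForm (hφ : ContDiff ℝ ∞ φ) {z : Fin n → ℂ} (hz : z ∈ torus n) :
    ContDiffAt ℝ ∞ (actionAngleForm φ) z := by
  have hφ' : ContDiff ℝ ∞ (fderiv ℝ φ) := (contDiff_infty_iff_fderiv.1 hφ).2
  have hLog := contDiffOn_Log.contDiffAt (isOpen_torus.mem_nhds hz)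
  unfold actionAngleForm
  refine ContDiffAt.sum fun j _ => ?_
  simp only [gradient_apply]
  exact ((hφ'.contDiffAt.comp z hLog).clm_apply contDiffAt_const).smul (contDiffAt_dThetaL j hz)

/-- Linear functionals as alternating `1`-forms. -/
def oneForm : ((Fin n → ℂ) →L[ℝ] ℝ) ≃ₗᵢ[ℝ] ((Fin n → ℂ) [⋀^Fin 1]→L[ℝ] ℝ) :=
  ContinuousAlternatingMap.ofSubsingletonLIE (0 : Fin 1)

/-- The form `∑_j d(∂φ/∂u_j) ∧ dθ_j`. -/
def potentialForm (φ : EuclideanSpace ℝ (Fin n) → ℝ) :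
    (Fin n → ℂ) → (Fin n → ℂ) [⋀^Fin 2]→L[ℝ] ℝ :=
  extDeriv fun z => oneForm
    (actionAngleForm φ z)

/-- The last sum is symmetric in `v` and `w`, so it cancels in the exterior derivative; this is the
closedness of each `dθ_j`. -/
theorem fderiv_actionAngleForm_apply (hφ : ContDiff ℝ ∞ φ) {z : Fin n → ℂ} (hz : z ∈ torus n)
    (v w : Fin n → ℂ) :
    fderiv ℝ (fun y => actionAngleForm φ y w) z v =
      fderiv ℝ (fderiv ℝ φ) (Log z) (dLog z v) (dArg z w)
        - ∑ j, gradient φ (Log z) j * (v j * w j / z j ^ 2).im := by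
  have hinv : ∀ j, HasFDerivAt (fun y : Fin n → ℂ => (w j / y j).im)
      (Complex.imCLM ∘L ((-(w j / z j ^ 2)) • .proj j)) z := fun j => by
    have h1 : HasDerivAt (fun y : ℂ => w j / y) (-(w j / z j ^ 2)) (z j) := by
      have := (hasDerivAt_inv (hz j)).const_mul (w j)
      simpa [div_eq_mul_inv] using this
    have h2 := Complex.imCLM.hasFDerivAt.comp z ((h1.hasFDerivAt.restrictScalars ℝ).comp z
      (ContinuousLinearMap.proj (R := ℝ) (φ := fun _ : Fin n => ℂ) j).hasFDerivAt)
    refine h2.congr_fderiv ?_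
    ext x
    simp [mul_comm]
  have he : (fun y => actionAngleForm φ y w) =
      fun y => ∑ j, gradient φ (Log y) j * (w j / y j).im := by
    ext y
    simp [actionAngleForm, dThetaL_apply]
  have h : HasFDerivAt (fun y => ∑ j, gradient φ (Log y) j * (w j / y j).im) _ z :=
    HasFDerivAt.fun_sum fun j (_ : j ∈ Finset.univ) =>
      (hasFDerivAt_gradient_Log hφ hz j).mul (hinv j)
  rw [he, h.fderiv, ← sum_fderiv_gradient_mul_dTheta hφ hz, ← Finset.sum_sub_distrib]
  simp only [_root_.sum_apply]
  refine Finset.sum_congr rfl fun j _ => ?_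
  have : -(w j / z j ^ 2) * v j = -(v j * w j / z j ^ 2) := by ring
  simp only [fderiv_gradient_Log hφ hz, dTheta, add_apply,
    smul_apply, ContinuousLinearMap.comp_apply, Complex.imCLM_apply,
    ContinuousLinearMap.proj_apply, smul_eq_mul, ContinuousLinearMap.flip_apply, this,
    Complex.neg_im]
  ring

theorem potentialForm_apply (hφ : ContDiff ℝ ∞ φ) {z : Fin n → ℂ} (hz : z ∈ torus n)
    (v w : Fin n → ℂ) : potentialForm φ z ![v, w] =
      fderiv ℝ (fderiv ℝ φ) (Log z) (dLog z v) (dArg z w)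
        - fderiv ℝ (fderiv ℝ φ) (Log z) (dLog z w) (dArg z v) := by
  have hd : DifferentiableAt ℝ (fun z => oneForm (actionAngleForm φ z)) z :=
    (oneForm).differentiable.differentiableAt.comp z
        ((contDiffAt_actionAngleForm hφ hz).differentiableAt (by simp))
  have hval : ∀ (y : Fin n → ℂ) (x : Fin 1 → Fin n → ℂ),
      oneForm
        (actionAngleForm φ y) x = actionAngleForm φ y (x 0) := fun _ _ => rfl
  rw [potentialForm, extDeriv_apply hd, Fin.sum_univ_two]
  simp only [hval]
  have h0 : (Fin.removeNth 0 ![v, w] : Fin 1 → Fin n → ℂ) 0 = w := rfl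
  have h1 : (Fin.removeNth 1 ![v, w] : Fin 1 → Fin n → ℂ) 0 = v := rfl
  rw [h0, h1]
  simp only [Fin.val_zero, Fin.val_one, pow_zero, pow_one, one_smul, neg_smul,
    Matrix.cons_val_zero, Matrix.cons_val_one, fderiv_actionAngleForm_apply hφ hz]
  simp only [mul_comm (v _) (w _)]
  ring

theorem hasPotential_potentialForm (hφ : ContDiff ℝ ∞ φ) : HasPotential (potentialForm φ) φ := by
  intro z hz v w
  rw [potentialForm_apply hφ hz, Finset.sum_sub_distrib, sum_fderiv_gradient_mul_dTheta hφ hz,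
    sum_fderiv_gradient_mul_dTheta hφ hz]

/-- The form is exact, hence closed. Multiplication by `i` takes `(dLog, dArg)` to `(-dArg, dLog)`,
so compatibility is the symmetry of the Hessian `H`, and `Ω(v, iv) = H(dLog v, dLog v) + H(dArg v,
dArg v)`. -/
theorem isToricKahlerForm_potentialForm (hφ : ContDiff ℝ ∞ φ)
    (hpos : ∀ u v, v ≠ 0 → 0 < fderiv ℝ (fderiv ℝ φ) u v v) :
    IsToricKahlerForm (potentialForm φ) where
  smooth z hz := by
    have h := (oneForm).contDiff.contDiffAt.comp z (contDiffAt_actionAngleForm hφ hz)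
    have h2 := h.fderiv_right (m := ∞) (by simp)
    exact ((ContinuousAlternatingMap.alternatizeUncurryFinCLM ℝ (Fin n → ℂ)
      ℝ (n := 1)).contDiff.contDiffAt.comp z h2).contDiffWithinAt
  closed z hz := by
    have h := (oneForm).contDiff.contDiffAt.comp z (contDiffAt_actionAngleForm hφ hz)
    exact extDeriv_extDeriv_apply h (by
      rw [minSmoothness_of_isRCLikeNormedField]
      exact WithTop.coe_le_coe.2 le_top)
  compatible z hz v w := by
    have hsymm : IsSymmSndFDerivAt ℝ φ (Log z) := hφ.contDiffAt.isSymmSndFDerivAt (by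
      rw [minSmoothness_of_isRCLikeNormedField]
      exact WithTop.coe_le_coe.2 le_top)
    rw [potentialForm_apply hφ hz, potentialForm_apply hφ hz]
    simp only [dLog_I_smul, dArg_I_smul, map_neg, neg_apply]
    rw [hsymm.eq (dArg z v), hsymm.eq (dArg z w)]
    ring
  positive z hz v hv := by
    rw [potentialForm_apply hφ hz]
    simp only [dLog_I_smul, dArg_I_smul, map_neg, neg_apply, sub_neg_eq_add]
    have hnn : ∀ x, 0 ≤ fderiv ℝ (fderiv ℝ φ) (Log z) x x := fun x => by
      rcases eq_or_ne x 0 with rfl | hx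
      · simp
      · exact (hpos _ x hx).le
    by_cases h1 : dLog z v = 0
    · have h2 : dArg z v ≠ 0 := fun h2 => hv (eq_zero_of_dLog_dArg hz h1 h2)
      exact add_pos_of_nonneg_of_pos (hnn _) (hpos _ _ h2)
    · exact add_pos_of_pos_of_nonneg (hpos _ _ h1) (hnn _)
  invariant t ht z hz v w := by
    have htz : t * z ∈ torus n := fun i =>
      mul_ne_zero (norm_ne_zero_iff.1 (by simp [ht i])) (hz i)
    rw [potentialForm_apply hφ hz, potentialForm_apply hφ htz]
    simp only [Log_mul ht, dLog_mul ht, dArg_mul ht]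

theorem isMomentMap_gradient_Log (hφ : ContDiff ℝ ∞ φ) :
    IsMomentMap (potentialForm φ) fun z => gradient φ (Log z) where
  differentiable z hz :=
    differentiableAt_euclidean.2 fun j => (hasFDerivAt_gradient_Log hφ hz j).differentiableAt
  hamiltonian z hz j v := by
    rw [potentialForm_apply hφ hz, fderiv_gradient_Log hφ hz, dLog_rotationField hz,
      dArg_rotationField hz]
    simp
  invariant t ht z hz := by simp only [Log_mul ht]

end TorusForm

/-! ### Interiors of stars -/

namespace SmoothFan

variable {n : ℕ} (F : SmoothFan n)

theorem inner_nonneg_of_mem_coneOf {S : Finset (Fin n → ℤ)} {ℓ u : EuclideanSpace ℝ (Fin n)}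
    (hℓ : ∀ β ∈ S, 0 ≤ inner ℝ ℓ (toReal β)) (hu : u ∈ coneOf S) : 0 ≤ inner ℝ ℓ u := by
  obtain ⟨a, ha, rfl⟩ := hu
  rw [inner_sum]
  refine Finset.sum_nonneg fun β hβ => ?_
  rw [inner_smul_right]
  exact mul_nonneg (ha β hβ) (hℓ β hβ)

/-- The separating half-spaces are open and the cones finite in number, so a whole neighbourhood of
`y` avoids every cone without `α`; completeness puts it in the star. -/
theorem mem_interior_star (hF : F.IsComplete) {α : Fin n → ℤ} {y : EuclideanSpace ℝ (Fin n)}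
    (h : ∀ S ∈ F.cones, α ∉ S → ∃ ℓ : EuclideanSpace ℝ (Fin n), inner ℝ ℓ y < 0 ∧
      ∀ β ∈ S, 0 ≤ inner ℝ ℓ (toReal β)) : y ∈ interior (F.star α) := by
  rw [mem_interior_iff_mem_nhds]
  have hev : ∀ᶠ z in 𝓝 y, ∀ S ∈ F.cones, α ∉ S → z ∉ coneOf S := by
    rw [eventually_all_finset]
    intro S hS
    by_cases hα : α ∈ S
    · simp [hα]
    · obtain ⟨ℓ, hy, hℓ⟩ := h S hS hα
      have hc : Continuous fun z => inner ℝ ℓ z := continuous_const.inner continuous_id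
      filter_upwards [hc.continuousAt.eventually (gt_mem_nhds hy)] with z hz _ hzS
      exact hz.not_ge (inner_nonneg_of_mem_coneOf hℓ hzS)
  filter_upwards [hev] with z hz
  obtain ⟨S, hS, hzS⟩ := hF z
  by_cases hα : α ∈ S
  · exact ⟨S, hS, hα, hzS⟩
  · exact absurd hzS (hz S hS hα)

/-- If `u` pairs nonpositively with all rays, then it does so with the cone containing it, so `⟨u,
u⟩ ≤ 0`. -/
theorem IsComplete.exists_inner_pos {F : SmoothFan n} (hF : F.IsComplete)
    {u : EuclideanSpace ℝ (Fin n)} (hu : u ≠ 0) :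
    ∃ α : F.rays, 0 < inner ℝ (toReal (α : Fin n → ℤ)) u := by
  by_contra! h
  obtain ⟨S, hS, hmem⟩ := hF u
  have := inner_nonneg_of_mem_coneOf (ℓ := -u) (fun β hβ => by
    rw [inner_neg_left, real_inner_comm, neg_nonneg]
    exact h ⟨β, F.mem_rays_of_mem hS hβ⟩) hmem
  rw [inner_neg_left, neg_nonneg] at this
  exact hu (inner_self_eq_zero (𝕜 := ℝ)|>.1 (le_antisymm this real_inner_self_nonneg))

theorem IsComplete.rays_nonempty {F : SmoothFan n} (hF : F.IsComplete) (hn : 0 < n) :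
    F.rays.Nonempty := by
  have h : EuclideanSpace.single (⟨0, hn⟩ : Fin n) (1 : ℝ) ≠ 0 := by simp
  obtain ⟨α, -⟩ := hF.exists_inner_pos h
  exact ⟨α, α.2⟩

theorem mul_exp_sub_le (x M : ℝ) : Real.exp x * (M - x) ≤ Real.exp M := by
  have h := Real.add_one_le_exp (M - x)
  have h2 : Real.exp x * Real.exp (M - x) = Real.exp M := by rw [← Real.exp_add]; congr 1; ring
  rw [← h2]
  exact mul_le_mul_of_nonneg_left (by linarith) (Real.exp_pos x).le

/-- If the exponential sum is large at `v` and `α` is nearly dominant there, then the exponentially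
weighted sum of the rays lies in the interior of the star of `α`. -/
theorem weighted_sum_mem_interior_star (hF : F.IsComplete) {c L : ℝ} (hc : 0 < c)
    (hm : ∀ S ∈ F.cones, ∀ α ∈ F.rays, α ∉ S → ∃ m : EuclideanSpace ℝ (Fin n),
      (∀ β ∈ S, inner ℝ m (toReal β) = 1) ∧ (∀ β ∈ F.rays, inner ℝ m (toReal β) ≤ 1) ∧
        inner ℝ m (toReal α) ≤ 1 - c)
    (hL : F.rays.card * Real.exp (F.rays.card * Real.exp 1 / c) < L)
    {v : EuclideanSpace ℝ (Fin n)}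
    (hv : ∑ β ∈ F.rays, Real.exp (inner ℝ (toReal β) v) = L)
    {α : Fin n → ℤ} (hα : α ∈ F.rays)
    (hdom : ∀ β ∈ F.rays, inner ℝ (toReal β) v ≤ inner ℝ (toReal α) v + 1)
    {r : ℝ} (hr : 0 < r) :
    r • ∑ β ∈ F.rays, Real.exp (inner ℝ (toReal β) v) • toReal β ∈ interior (F.star α) := by
  set M := inner ℝ (toReal α) v + 1 with hM
  have hcard : (0 : ℝ) < F.rays.card := Nat.cast_pos.2 (Finset.card_pos.2 ⟨α, hα⟩)
  have hMlt : F.rays.card * Real.exp 1 / c < M := by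
    have h1 : L ≤ F.rays.card * Real.exp M := by
      rw [← hv, ← nsmul_eq_mul]
      exact Finset.sum_le_card_nsmul _ _ _ fun β hβ => Real.exp_le_exp.2 (hdom β hβ)
    exact Real.exp_lt_exp.1 (lt_of_mul_lt_mul_left (hL.trans_le h1) hcard.le)
  have hM0 : 0 ≤ M := le_trans (by positivity) hMlt.le
  refine F.mem_interior_star hF fun S hS hαS => ?_
  obtain ⟨m, hmS, hm1, hmα⟩ := hm S hS α hα hαS
  -- On `S` this functional is `M - ⟨β, v⟩ ≥ 0` by near-dominance of `α`.
  refine ⟨M • m - v, ?_, fun β hβ => ?_⟩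
  · rw [inner_smul_right]
    refine mul_neg_of_pos_of_neg hr ?_
    rw [inner_sum]
    -- Every ray costs at most `exp M`, by the tangent line bound; the drop `c` of `m` at `α` saves
    -- `M c exp (M - 1)`.
    have hterm : ∀ β ∈ F.rays, inner ℝ (M • m - v) (Real.exp (inner ℝ (toReal β) v) • toReal β) ≤
        Real.exp M - if β = α then M * c * Real.exp (M - 1) else 0 := fun β hβ => by
      have hexp := mul_exp_sub_le (inner ℝ (toReal β) v) M
      rw [inner_smul_right, inner_sub_left, inner_smul_left, real_inner_comm _ v]
      simp only [RCLike.conj_to_real]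
      split_ifs with h
      · subst h
        have h1 : M * inner ℝ m (toReal β) ≤ M * (1 - c) := mul_le_mul_of_nonneg_left hmα hM0
        have h2 := mul_le_mul_of_nonneg_left h1 (Real.exp_pos (inner ℝ (toReal β) v)).le
        have h3 : M - 1 = inner ℝ (toReal β) v := by rw [hM]; ring
        rw [h3]
        linarith
      · have h1 : M * inner ℝ m (toReal β) ≤ M * 1 := mul_le_mul_of_nonneg_left (hm1 β hβ) hM0
        have h2 := mul_le_mul_of_nonneg_left h1 (Real.exp_pos (inner ℝ (toReal β) v)).le
        linarith
    refine (Finset.sum_le_sum hterm).trans_lt ?_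
    rw [Finset.sum_sub_distrib, Finset.sum_ite_eq' F.rays α, if_pos hα, Finset.sum_const,
      nsmul_eq_mul]
    rw [div_lt_iff₀ hc] at hMlt
    have h1 : Real.exp M = Real.exp 1 * Real.exp (M - 1) := by rw [← Real.exp_add]; congr 1; ring
    rw [h1, ← mul_assoc, ← sub_mul]
    exact mul_neg_of_neg_of_pos (sub_neg.2 hMlt) (Real.exp_pos _)
  · rw [inner_sub_left, inner_smul_left, hmS β hβ, real_inner_comm _ v]
    simpa using hdom β (F.mem_rays_of_mem hS hβ)

end SmoothFan

/-! ### Monomials in logarithmic coordinates -/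

variable {n : ℕ}

theorem norm_monomial {z : Fin n → ℂ} (hz : z ∈ torus n) (α : Fin n → ℤ) :
    ‖monomial z α‖ = Real.exp (inner ℝ (toReal α) (Log z)) := by
  have h : inner ℝ (toReal α) (Log z) = ∑ i, Real.log ‖z i‖ * (α i : ℝ) := by
    simp [PiLp.inner_apply, toReal, Log]
  rw [h, Real.exp_sum, monomial, norm_prod]
  refine Finset.prod_congr rfl fun i _ => ?_
  rw [norm_zpow, Real.exp_mul, Real.exp_log (norm_pos_iff.2 (hz i)), Real.rpow_intCast]

/-- The point of the torus with given logarithms and arguments. -/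
def polarPoint (p : EuclideanSpace ℝ (Fin n) × (Fin n → ℂ)) (i : Fin n) : ℂ :=
  (Real.exp (p.1 i) : ℂ) * p.2 i

theorem continuous_polarPoint : Continuous (polarPoint (n := n)) := by
  unfold polarPoint
  fun_prop

theorem polarPoint_mem_torus {p : EuclideanSpace ℝ (Fin n) × (Fin n → ℂ)}
    (hp : ∀ i, ‖p.2 i‖ = 1) : polarPoint p ∈ torus n := fun i =>
  mul_ne_zero (by exact_mod_cast (Real.exp_pos _).ne') (norm_ne_zero_iff.1 (by simp [hp i]))

theorem Log_polarPoint {p : EuclideanSpace ℝ (Fin n) × (Fin n → ℂ)}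
    (hp : ∀ i, ‖p.2 i‖ = 1) : Log (polarPoint p) = p.1 := by
  ext i
  simp only [Log, polarPoint, norm_mul, hp i, mul_one, Complex.norm_real, Real.norm_eq_abs,
    Real.abs_exp, Real.log_exp]

theorem exists_Log_eq (u : EuclideanSpace ℝ (Fin n)) : ∃ z ∈ torus n, Log z = u :=
  ⟨polarPoint (u, 1), polarPoint_mem_torus (by simp), Log_polarPoint (by simp)⟩

theorem exists_polarPoint_eq {z : Fin n → ℂ} (hz : z ∈ torus n) :
    ∃ t : Fin n → ℂ, (∀ i, ‖t i‖ = 1) ∧ polarPoint (Log z, t) = z := by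
  refine ⟨fun i => z i / ‖z i‖, fun i => by simp [hz i], ?_⟩
  ext1 i
  have h : (‖z i‖ : ℂ) ≠ 0 := by simpa using hz i
  simp only [polarPoint, Log, Real.exp_log (norm_pos_iff.2 (hz i))]
  field_simp

/-- In polar coordinates the set is the image of `Q` times a compact torus. -/
theorem isCompact_torus_inter_preimage_Log {Q : Set (EuclideanSpace ℝ (Fin n))} (hQ : IsCompact Q) :
    IsCompact (torus n ∩ Log ⁻¹' Q) := by
  have h : torus n ∩ Log ⁻¹' Q =
      polarPoint '' (Q ×ˢ Set.univ.pi fun _ => Metric.sphere (0 : ℂ) 1) := by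
    ext z
    constructor
    · rintro ⟨hz, hQz⟩
      obtain ⟨t, ht, hzt⟩ := exists_polarPoint_eq hz
      exact ⟨(Log z, t), ⟨hQz, fun i _ => by simpa using ht i⟩, hzt⟩
    · rintro ⟨⟨u, t⟩, ⟨hu, ht⟩, rfl⟩
      have ht' : ∀ i, ‖t i‖ = 1 := fun i => by simpa using ht i (Set.mem_univ i)
      refine ⟨polarPoint_mem_torus ht', ?_⟩
      rw [Set.mem_preimage, Log_polarPoint ht']
      exact hu
  rw [h]
  exact (hQ.prod (isCompact_univ_pi fun _ => isCompact_sphere _ _)).image continuous_polarPoint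

/-- The region in logarithmic coordinates where the term of `α` is dominant up to the factor
`1 - δ`. -/
def dominantRegion (A : Finset (Fin n → ℤ)) (c : (Fin n → ℤ) → ℂ) (δ : ℝ) (α : Fin n → ℤ) :
    Set (EuclideanSpace ℝ (Fin n)) :=
  {u | ∀ β ∈ A, (1 - δ) * (‖c β‖ * Real.exp (inner ℝ (toReal β) u)) ≤
    ‖c α‖ * Real.exp (inner ℝ (toReal α) u)}

theorem isClosed_dominantRegion (A : Finset (Fin n → ℤ)) (c : (Fin n → ℤ) → ℂ) (δ : ℝ)
    (α : Fin n → ℤ) : IsClosed (dominantRegion A c δ α) := by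
  have h : dominantRegion A c δ α = ⋂ β ∈ A, {u | (1 - δ) * (‖c β‖ *
      Real.exp (inner ℝ (toReal β) u)) ≤ ‖c α‖ * Real.exp (inner ℝ (toReal α) u)} := by
    ext
    simp [dominantRegion]
  rw [h]
  exact isClosed_biInter fun β _ => isClosed_le (by fun_prop) (by fun_prop)

theorem Log_mem_dominantRegion_iff {A : Finset (Fin n → ℤ)} {c : (Fin n → ℤ) → ℂ} {δ : ℝ}
    {α : Fin n → ℤ} {z : Fin n → ℂ} (hz : z ∈ torus n) :
    Log z ∈ dominantRegion A c δ α ↔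
      ∀ β ∈ A, (1 - δ) * ‖c β * monomial z β‖ ≤ ‖c α * monomial z α‖ := by
  simp only [norm_mul, norm_monomial hz]
  rfl

theorem tropicalDivision_eq_image (A : Finset (Fin n → ℤ)) (c : (Fin n → ℤ) → ℂ)
    (Φ : EuclideanSpace ℝ (Fin n) → EuclideanSpace ℝ (Fin n)) (δ : ℝ) (α : Fin n → ℤ) :
    tropicalDivision A c (fun z => Φ (Log z)) δ α = Φ '' dominantRegion A c δ α := by
  ext p
  constructor
  · rintro ⟨z, ⟨hz, h⟩, rfl⟩
    exact ⟨Log z, (Log_mem_dominantRegion_iff hz).2 h, rfl⟩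
  · rintro ⟨u, hu, rfl⟩
    obtain ⟨z, hz, rfl⟩ := exists_Log_eq u
    exact ⟨z, ⟨hz, (Log_mem_dominantRegion_iff hz).1 hu⟩, rfl⟩

theorem isMonomialDivision_tropicalDivision {A : Finset (Fin n → ℤ)} (hA : A.Nonempty)
    (c : (Fin n → ℤ) → ℂ) {Φ : EuclideanSpace ℝ (Fin n) → EuclideanSpace ℝ (Fin n)}
    (hclosed : IsClosedMap Φ) (hsurj : Function.Surjective Φ) {δ : ℝ} (hδ : 0 ≤ δ) :
    IsMonomialDivision A c (fun z => Φ (Log z)) (fun _ => 1)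
      (tropicalDivision A c (fun z => Φ (Log z)) δ) := by
  have hmax : ∀ z ∈ torus n, ∃ α ∈ A,
      Φ (Log z) ∈ tropicalDivision A c (fun z => Φ (Log z)) δ α ∧
      ∀ β ∈ A, ‖c β * monomial z β‖ ≤ ‖c α * monomial z α‖ := fun z hz => by
    obtain ⟨α, hα, hle⟩ := A.exists_max_image (fun β => ‖c β * monomial z β‖) hA
    refine ⟨α, hα, ⟨z, ⟨hz, fun β hβ => ?_⟩, rfl⟩, hle⟩
    exact (mul_le_of_le_one_left (norm_nonneg _) (by linarith)).trans (hle β hβ)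
  refine ⟨fun α _ => ?_, ⟨∅, isCompact_empty, fun p _ => ?_⟩, fun _ _ => one_pos, fun z hz => ?_⟩
  · rw [tropicalDivision_eq_image]
    exact hclosed _ (isClosed_dominantRegion A c δ α)
  · obtain ⟨u, rfl⟩ := hsurj p
    obtain ⟨z, hz, rfl⟩ := exists_Log_eq u
    obtain ⟨α, hα, h, -⟩ := hmax z hz
    exact ⟨α, hα, h⟩
  · simpa only [Real.rpow_one] using hmax z hz

/-- Bounded comparison of exponents on the dominant region. -/
theorem exists_inner_le_of_mem_dominantRegion (A : Finset (Fin n → ℤ)) {c : (Fin n → ℤ) → ℂ}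
    (hc : ∀ α ∈ A, c α ≠ 0) {α : Fin n → ℤ} (hα : α ∈ A) :
    ∃ B : ℝ, 0 ≤ B ∧ ∀ δ ≤ (1 / 2 : ℝ), ∀ u ∈ dominantRegion A c δ α, ∀ β ∈ A,
      inner ℝ (toReal β) u ≤ inner ℝ (toReal α) u + B := by
  -- The factor 2 is the inverse of the lower bound `1 / 2` for `1 - δ`.
  refine ⟨∑ β ∈ A, |Real.log (2 * ‖c α‖ / ‖c β‖)|, Finset.sum_nonneg fun _ _ => abs_nonneg _,
    fun δ hδ u hu β hβ => ?_⟩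
  have hα0 : 0 < ‖c α‖ := norm_pos_iff.2 (hc α hα)
  have hβ0 : 0 < ‖c β‖ := norm_pos_iff.2 (hc β hβ)
  have h1 := hu β hβ
  have h2 : Real.exp (inner ℝ (toReal β) u) ≤
      2 * ‖c α‖ / ‖c β‖ * Real.exp (inner ℝ (toReal α) u) := by
    rw [div_mul_eq_mul_div, le_div_iff₀ hβ0]
    have h3 : 1 / 2 * (‖c β‖ * Real.exp (inner ℝ (toReal β) u)) ≤
        (1 - δ) * (‖c β‖ * Real.exp (inner ℝ (toReal β) u)) :=
      mul_le_mul_of_nonneg_right (by linarith) (by positivity)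
    linarith
  rw [← Real.exp_log (by positivity : 0 < 2 * ‖c α‖ / ‖c β‖), ← Real.exp_add,
    Real.exp_le_exp] at h2
  have h4 := Finset.single_le_sum (f := fun β => |Real.log (2 * ‖c α‖ / ‖c β‖)|)
    (fun _ _ => abs_nonneg _) hβ
  have h5 := le_abs_self (Real.log (2 * ‖c α‖ / ‖c β‖))
  linarith

/-! ### The radial potential of a Fano fan -/

theorem isRadialPotential_gaugePotential {ι : Type*} [Fintype ι]
    (a : ι → EuclideanSpace ℝ (Fin n)) {L : ℝ} (hL : Fintype.card ι < L)
    (hpos : ∀ u v, v ≠ 0 → 0 < fderiv ℝ (fderiv ℝ (gaugePotential a hL)) u v v)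
    {C : ℝ} (hC : 0 < C) (hbound : ∀ u, ‖u‖ ≤ C * smoothGauge a hL u)
    {c : ℝ} (hc : 0 < c) (hcoer : ∀ u, c * ‖u‖ ^ 2 ≤ gaugePotential a hL u) :
    IsRadialPotential (gaugePotential a hL) := by
  have hφ := contDiff_gaugePotential a hL
  refine ⟨hφ, strictConvexOn_univ_of_hessian_pos hφ hpos, fun u v h => ?_,
    ⟨gradient_injective_of_hessian_pos hφ hpos,
      gradient_surjective_of_coercive (hφ.differentiable (by simp)) hc hcoer⟩,
    -- Outside this ball `T ≥ 2`, where the tail vanishes and the gradient is homogeneous.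
    Metric.closedBall 0 (C * 2), isCompact_closedBall _ _, fun u hu t ht htu => ⟨t, ht, ?_⟩⟩
  · by_contra hv
    have := h v
    rw [iteratedFDeriv_two_apply] at this
    exact (hpos u v hv).ne' this
  · have key : ∀ x : EuclideanSpace ℝ (Fin n), x ∉ Metric.closedBall 0 (C * 2) →
        2 ≤ smoothGauge a hL x := fun x hx => by
      rw [mem_closedBall_zero_iff, not_le] at hx
      exact (lt_of_mul_lt_mul_left (hx.trans_le (hbound x)) hC.le).le
    exact gradient_gaugePotential_smul a hL ht (key u hu) (key _ htu)

/-- The coefficients spoil dominance of `α` by at most `B`. Outside a ball depending on `B` the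
gauge is at least `2 + B`: the 2 removes the tail, and dividing by `T` shrinks the error `B` below
1. Only the discarded compact set, not the potential, depends on the coefficients. -/
theorem isAdapted_tropicalDivision {F : SmoothFan n} (hF : F.IsComplete)
    {L : ℝ} (hL : Fintype.card F.rays < L) {c : ℝ} (hc : 0 < c)
    (hm : ∀ S ∈ F.cones, ∀ α ∈ F.rays, α ∉ S → ∃ m : EuclideanSpace ℝ (Fin n),
      (∀ β ∈ S, inner ℝ m (toReal β) = 1) ∧ (∀ β ∈ F.rays, inner ℝ m (toReal β) ≤ 1) ∧
        inner ℝ m (toReal α) ≤ 1 - c)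
    (hLc : F.rays.card * Real.exp (F.rays.card * Real.exp 1 / c) < L)
    (hinj : Function.Injective
      (gradient (gaugePotential (fun α : F.rays => toReal (α : Fin n → ℤ)) hL))) {C : ℝ} (hC : 0 < C)
    (hbound : ∀ u, ‖u‖ ≤ C * smoothGauge (fun α : F.rays => toReal (α : Fin n → ℤ)) hL u)
    {w : (Fin n → ℤ) → ℂ} (hw : ∀ α ∈ F.rays, w α ≠ 0) {δ : ℝ} (hδ : δ ≤ 1 / 2) :
    IsAdapted F
      (fun z => gradient (gaugePotential (fun α : F.rays => toReal (α : Fin n → ℤ)) hL) (Log z))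
      (tropicalDivision F.rays w (fun z =>
        gradient (gaugePotential (fun α : F.rays => toReal (α : Fin n → ℤ)) hL) (Log z)) δ) := by
  set φ := gaugePotential (fun α : F.rays => toReal (α : Fin n → ℤ)) hL with hφ
  intro α hα
  obtain ⟨B, hB, hdom⟩ := exists_inner_le_of_mem_dominantRegion F.rays hw hα
  set Q := Metric.closedBall (0 : EuclideanSpace ℝ (Fin n)) (C * (2 + B)) ∩
    dominantRegion F.rays w δ α with hQ
  have hmem : ∀ z : Fin n → ℂ, gradient φ (Log z) ∈
      tropicalDivision F.rays w (fun z => gradient φ (Log z)) δ α ↔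
        Log z ∈ dominantRegion F.rays w δ α := fun z => by
    rw [tropicalDivision_eq_image, hinj.mem_set_image]
  refine ⟨torus n ∩ Log ⁻¹' Q, fun z hz => ⟨hz.1, (hmem z).2 hz.2.2⟩,
    isCompact_torus_inter_preimage_Log
      ((isCompact_closedBall _ _).inter_right (isClosed_dominantRegion _ _ _ _)), ?_⟩
  rintro z ⟨⟨hz, hzC⟩, hzQ⟩
  have hzR := (hmem z).1 hzC
  set u := Log z with hu
  set T := smoothGauge (fun α : F.rays => toReal (α : Fin n → ℤ)) hL u with hT
  have hT0 : 0 < T := smoothGauge_pos _ hL u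
  have hTlarge : 2 + B ≤ T := by
    have hnot : u ∉ Metric.closedBall (0 : EuclideanSpace ℝ (Fin n)) (C * (2 + B)) :=
      fun h => hzQ ⟨hz, h, hzR⟩
    rw [mem_closedBall_zero_iff, not_le] at hnot
    exact (lt_of_mul_lt_mul_left (hnot.trans_le (hbound u)) hC.le).le
  have hdiv : ∀ β : Fin n → ℤ, inner ℝ (toReal β) (T⁻¹ • u) = inner ℝ (toReal β) u / T := fun β => by
    rw [inner_smul_right, div_eq_inv_mul]
  have hsum : ∑ β ∈ F.rays, Real.exp (inner ℝ (toReal β) (T⁻¹ • u)) = L := by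
    rw [← Finset.sum_coe_sort, ← sum_exp_smoothGauge_eq _ hL (u := u) (by linarith)]
    exact Finset.sum_congr rfl fun β _ => by rw [hdiv]
  have h := F.weighted_sum_mem_interior_star hF hc hm hLc hsum hα (fun β hβ => by
    rw [hdiv, hdiv, div_add_one hT0.ne', div_le_div_iff_of_pos_right hT0]
    linarith [hdom δ hδ u hzR β hβ])
    (div_pos hT0 (gaugeSlope_pos (fun α : F.rays => toReal (α : Fin n → ℤ)) hL (u, T)))
  rw [← Finset.sum_coe_sort] at h
  simp only [hdiv] at h
  change gradient φ u ∈ _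
  rw [hφ, gradient_gaugePotential]
  exact h

/-- A Fano fan has a radial potential with positive definite Hessian for which the tropical
divisions with parameter at most `1 / 2` are adapted monomial divisions. -/
theorem SmoothFan.IsFano.exists_adapted_potential (hn : 0 < n) {F : SmoothFan n} (hF : F.IsFano) :
    ∃ φ : EuclideanSpace ℝ (Fin n) → ℝ,
      (∀ u v, v ≠ 0 → 0 < fderiv ℝ (fderiv ℝ φ) u v v) ∧ IsRadialPotential φ ∧
      ∀ w : (Fin n → ℤ) → ℂ, (∀ α ∈ F.rays, w α ≠ 0) → ∀ δ : ℝ, 0 ≤ δ → δ ≤ 1 / 2 →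
        IsMonomialDivision F.rays w (fun z => gradient φ (Log z)) (fun _ => 1)
          (tropicalDivision F.rays w (fun z => gradient φ (Log z)) δ) ∧
        IsAdapted F (fun z => gradient φ (Log z))
          (tropicalDivision F.rays w (fun z => gradient φ (Log z)) δ) := by
  obtain ⟨c, hc, hm⟩ := hF.exists_support_functional
  have hspan := fun (u : EuclideanSpace ℝ (Fin n)) (hu : u ≠ 0) => hF.complete.exists_inner_pos hu
  set a : F.rays → EuclideanSpace ℝ (Fin n) := fun α => toReal (α : Fin n → ℤ) with ha
  obtain ⟨L, hLc⟩ := exists_gt (F.rays.card * Real.exp (F.rays.card * Real.exp 1 / c))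
  have hL : (Fintype.card F.rays : ℝ) < L := by
    rw [Fintype.card_coe]
    exact (le_mul_of_one_le_right (Nat.cast_nonneg _)
      (Real.one_le_exp (by positivity))).trans_lt hLc
  obtain ⟨C, hC, hbound⟩ := exists_norm_le_smoothGauge a hL hspan
  have hφ := contDiff_gaugePotential a hL
  have hpos : ∀ u v, v ≠ 0 → 0 < fderiv ℝ (fderiv ℝ (gaugePotential a hL)) u v v :=
    fun u v hv => fderiv_fderiv_gaugePotential_pos a hL (fun x hx => by
      by_contra hx0
      obtain ⟨i, hi⟩ := hspan x hx0
      exact hi.ne' (hx i)) u hv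
  have hcoer : ∀ u, (2 * C ^ 2)⁻¹ * ‖u‖ ^ 2 ≤ gaugePotential a hL u := fun u => by
    have h := pow_le_pow_left₀ (norm_nonneg u) (hbound u) 2
    rw [inv_mul_le_iff₀ (by positivity), gaugePotential]
    linarith
  have hrad := isRadialPotential_gaugePotential a hL hpos hC hbound (by positivity) hcoer
  exact ⟨_, hpos, hrad, fun w hw δ hδ0 hδ =>
    ⟨isMonomialDivision_tropicalDivision (hF.complete.rays_nonempty hn) w
      (isClosedMap_gradient hφ hpos (by positivity) hcoer) hrad.bijective.2 hδ0,
    isAdapted_tropicalDivision hF.complete hL hc hm hLc hrad.bijective.1 hC hbound hw hδ⟩⟩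

end ToricMirror

end

theorem mainTheorem11 (n : ℕ) (hn : 0 < n) (F : ToricMirror.SmoothFan n) (hF : F.IsFano) :
    ∃ (Ω : (Fin n → ℂ) → (Fin n → ℂ) [⋀^Fin 2]→L[ℝ] ℝ)
      (φ : EuclideanSpace ℝ (Fin n) → ℝ) (μ : (Fin n → ℂ) → EuclideanSpace ℝ (Fin n)),
      ToricMirror.IsRadialToricKahler Ω φ ∧
      (∀ z, μ z = gradient φ (ToricMirror.Log z)) ∧
      ToricMirror.IsMomentMap Ω μ ∧
      (∀ c : (Fin n → ℤ) → ℂ, (∀ α ∈ F.rays, c α ≠ 0) →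
        ∃ C : (Fin n → ℤ) → Set (EuclideanSpace ℝ (Fin n)),
          ToricMirror.IsMonomialDivision F.rays c μ (fun _ => 1) C ∧
          ToricMirror.IsAdapted F μ C) ∧
      ∃ δ₀ : ℝ, 0 < δ₀ ∧ δ₀ ≤ 1 ∧
        ∀ c : (Fin n → ℤ) → ℂ, (∀ α ∈ F.rays, c α ≠ 0) →
          ∀ δ : ℝ, 0 ≤ δ → δ ≤ δ₀ →
            ToricMirror.IsMonomialDivision F.rays c μ (fun _ => 1)
              (ToricMirror.tropicalDivision F.rays c μ δ) ∧
            ToricMirror.IsAdapted F μ (ToricMirror.tropicalDivision F.rays c μ δ) := by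
  obtain ⟨φ, hpos, hrad, key⟩ := hF.exists_adapted_potential hn
  exact ⟨ToricMirror.potentialForm φ, φ, _,
    ⟨ToricMirror.isToricKahlerForm_potentialForm hrad.smooth hpos, hrad,
      ToricMirror.hasPotential_potentialForm hrad.smooth⟩,
    fun _ => rfl, ToricMirror.isMomentMap_gradient_Log hrad.smooth,
    -- The exact tropical division, `δ = 0`, serves for the first claim.
    fun w hw => ⟨_, key w hw 0 le_rfl (by norm_num)⟩,
    1 / 2, by norm_num, by norm_num, key⟩
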